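/- There is an absolute constant $C>0$ with the following property. Let $s<\delta<d$ be positive integers with $s\mid\delta$ and $\delta\mid d$; indices of vectors in $\mathbb C^d$ and matrices in $\mathbb C^{d\times d}$ are taken modulo $d$. Let $T_{\delta,s}$ be the operator on $\mathbb C^{d\times d}$ that keeps the entries with index in $\bigcup_{\ell=0}^{d/s-1}\{s\ell+1,\dots,s\ell+\delta\}^2$ and sets all others to $0$. Let $m_1,\dots,m_D\in\mathbb C^d$ be masks supported in $\{1,\dots,\delta\}$, let $S$ be the circular shift $(Sx)_i=x_{i-1}$, and let $$\mathcal A(Z)_{(\ell,j)}=\langle S^{s\ell}m_jm_j^*S^{-s\ell},Z\rangle=\operatorname{tr}\bigl(S^{s\ell}m_jm_j^*S^{-s\ell}Z\bigr),\qquad 0\le \ell<d/s,\ 1\le j\le D .$$ Assume that $\mathcal A$ is injective on $T_{\delta,s}(\mathbb C^{d\times d})$, let $\mathcal A^{-1}$ denote the inverse of $\mathcal A|_{T_{\delta,s}(\mathbb C^{d\times d})}$ (the Moore–Penrose, i.e. least-squares, inverse if this restriction is not onto), and let $\sigma_{\min}$ and $\kappa$ be the smallest singular value and the condition number of $\mathcal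 A|_{T_{\delta,s}(\mathbb C^{d\times d})}$ with respect to the Frobenius norm and the $\ell_2$ norm. Let $x_0\in\mathbb C^d$ have no zero entry, let $n\in\mathbb R^{(d/s)D}$ be arbitrary, and put $$X_0=T_{\delta,s}(x_0x_0^*),\qquad X=\mathcal A^{-1}\bigl(\mathcal A(x_0x_0^*)+n\bigr),\qquad \mathrm{SNR}=\frac{\|\mathcal A(X_0)\|_2}{\|n\|_2}.$$ Let $\operatorname{sgn}(z)=z/|z|$ for $z\ne0$, applied entrywise (with $\operatorname{sgn}(0)$ equal to $0$ or to $1$; the choice may differ between $X$ and $v$). Let $\widetilde X=T_{\delta,s}(\operatorname{sgn}(X))$ be the entrywise normalization of $X$, let $v$ be any eigenvector of the Hermitian matrix $\widetilde X$ for its largest eigenvalue, and let $\tilde x=\operatorname{sgn}(v)$. Then $$\min_{\theta\in[0,2\pi]}\|\operatorname{sgn}(x_0)-e^{\mathrm i\theta}\tilde x\|_2\le C\,\frac{d^2s}{\delta^{5/2}}\cdot\frac{\sigma_{\min}^{-1}\|n\|_2}{\min_j|(x_0)_j|^2}$$ and $$\min_{\theta\in[0,2\pi]}\|\operatorname{sgn}(x_0)-e^{\mathrm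 i\theta}\tilde x\|_2\le C\,\frac{d^2s}{\delta^{5/2}}\cdot\frac{\kappa\,\|X_0\|_F}{\mathrm{SNR}\cdot\min_j|(x_0)_j|^2}.$$ For $n=0$ (infinite SNR) the right-hand side of the second bound is read as $0$. -/

import Mathlib

noncomputable section

namespace Ptycho

/-- Complex `d × d` matrices, with indices taken modulo `d`, as a Hilbert space:
the norm is the Frobenius norm and the inner product is `⟨Y, X⟩ = trace (Y* X)`. -/
abbrev MatSpace (d : ℕ) : Type := EuclideanSpace ℂ (ZMod d × ZMod d)

/-- `(i, k)` lies in one of the index squares `{sℓ, sℓ+1, …, sℓ+δ-1}²`, `0 ≤ ℓ < d / s`,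
(indices modulo `d`, counted from `0`). -/
def InBand (d δ s : ℕ) (i k : ZMod d) : Prop :=
  ∃ ℓ < d / s, ∃ a < δ, ∃ b < δ,
    i = ((s * ℓ + a : ℕ) : ZMod d) ∧ k = ((s * ℓ + b : ℕ) : ZMod d)

open Classical in
/-- The operator `T_{δ,s}`: keep the entries with indices in the band, set the others to zero. -/
def bandProj (d δ s : ℕ) (X : MatSpace d) : MatSpace d :=
  WithLp.toLp 2 fun p => if InBand d δ s p.1 p.2 then X p else 0

/-- The subspace `T_{δ,s}(ℂ^{d×d})` of matrices supported on the band. -/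
def bandSpace (d δ s : ℕ) : Submodule ℂ (MatSpace d) where
  carrier := {X | ∀ i k, ¬ InBand d δ s i k → X (i, k) = 0}
  zero_mem' := fun _ _ _ => rfl
  add_mem' := fun {X Y} hX hY i k h => by simp [hX i k h, hY i k h]
  smul_mem' := fun c X hX i k h => by simp [hX i k h]

/-- `T_{δ,s}(ℂ^{d×d})` is the range of `T_{δ,s}`. -/
theorem mem_bandSpace_iff (d δ s : ℕ) (X : MatSpace d) :
    X ∈ bandSpace d δ s ↔ ∃ Y, bandProj d δ s Y = X := by
  constructor
  · intro hX
    refine ⟨X, ?_⟩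
    ext ⟨i, k⟩
    by_cases h : InBand d δ s i k
    · simp [bandProj, h]
    · simp [bandProj, h, hX i k h]
  · rintro ⟨Y, rfl⟩ i k h
    simp [bandProj, h]

/-- The rank-one matrix `x x*`. -/
def outer {d : ℕ} (x : ZMod d → ℂ) : MatSpace d :=
  WithLp.toLp 2 fun p => x p.1 * star (x p.2)

/-- The circular shift `S^t x`. -/
def shift {d : ℕ} (t : ℕ) (x : ZMod d → ℂ) : ZMod d → ℂ := fun i => x (i - (t : ZMod d))

/-- The measurement operator of the masks `m₀, …, m_{D-1}`:
`𝒜(X)_{(ℓ,j)} = ⟨S^{sℓ} m_j m_j* S^{-sℓ}, X⟩` for `0 ≤ ℓ < d / s` and `0 ≤ j < D`. -/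
def measOp (d s D : ℕ) [NeZero d] (m : Fin D → ZMod d → ℂ) :
    MatSpace d →ₗ[ℂ] EuclideanSpace ℂ (Fin (d / s) × Fin D) where
  toFun X := WithLp.toLp 2 fun p => inner ℂ (outer (shift (s * p.1) (m p.2))) X
  map_add' X Y := by ext p; simp
  map_smul' c X := by ext p; simp

/-- The restriction `𝒜|_{T_{δ,s}(ℂ^{d×d})}`. -/
def measOpBand (d δ s D : ℕ) [NeZero d] (m : Fin D → ZMod d → ℂ) :
    bandSpace d δ s →ₗ[ℂ] EuclideanSpace ℂ (Fin (d / s) × Fin D) :=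
  (measOp d s D m).domRestrict (bandSpace d δ s)

section SingularValues

variable {E F : Type*} [NormedAddCommGroup E] [InnerProductSpace ℂ E] [FiniteDimensional ℂ E]
  [NormedAddCommGroup F] [InnerProductSpace ℂ F] [FiniteDimensional ℂ F]

/-- The largest singular value of a linear map. -/
def sigmaMax (T : E →ₗ[ℂ] F) : ℝ := T.singularValues 0

/-- The smallest of the `dim E` singular values of a linear map on `E`. -/
def sigmaMin (T : E →ₗ[ℂ] F) : ℝ := T.singularValues (Module.finrank ℂ E - 1)

/-- The condition number of a linear map. -/
def condNumber (T : E →ₗ[ℂ] F) : ℝ := sigmaMax T / sigmaMin T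

end SingularValues

/-- A real vector regarded as a complex one. -/
def toComplexVec {ι : Type*} (n : EuclideanSpace ℝ ι) : EuclideanSpace ℂ ι :=
  WithLp.toLp 2 fun i => (n i : ℂ)

/-- `X = 𝒜|_{T_{δ,s}}⁻¹ y`: the matrix `X` in `T_{δ,s}(ℂ^{d×d})` that solves `𝒜(X) = y` in the
least-squares sense. If `𝒜` is bijective on `T_{δ,s}(ℂ^{d×d})`, this is the inverse image of `y`;
if it is only injective, the inverse is the Moore–Penrose inverse. -/
def IsBandSolution (d δ s D : ℕ) [NeZero d] (m : Fin D → ZMod d → ℂ)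
    (y : EuclideanSpace ℂ (Fin (d / s) × Fin D)) (X : MatSpace d) : Prop :=
  X ∈ bandSpace d δ s ∧
    ∀ Z ∈ bandSpace d δ s, ‖measOp d s D m X - y‖ ≤ ‖measOp d s D m Z - y‖

/-- `sgn z = z / |z|` for `z ≠ 0`, and `sgn 0 = c`. -/
def sgn (c z : ℂ) : ℂ := if z = 0 then c else z / (‖z‖ : ℂ)

/-- The entrywise sign of a vector. -/
def sgnVec {d : ℕ} (c : ℂ) (x : ZMod d → ℂ) : EuclideanSpace ℂ (ZMod d) :=
  WithLp.toLp 2 fun i => sgn c (x i)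

/-- The entrywise normalization `X̃` of `X`: the sign is taken on the band, and the entries off
the band are zero. -/
def phaseMatrix (d δ s : ℕ) (c : ℂ) (X : MatSpace d) : Matrix (ZMod d) (ZMod d) ℂ :=
  Matrix.of fun i k => bandProj d δ s (WithLp.toLp 2 fun p => sgn c (X p)) (i, k)

/-- `v` is an eigenvector of the (Hermitian) matrix `M` for its largest eigenvalue. -/
def IsLeadingEigenvector {d : ℕ} [NeZero d] (M : Matrix (ZMod d) (ZMod d) ℂ)
    (v : ZMod d → ℂ) : Prop :=
  v ≠ 0 ∧ ∃ lam : ℝ, M.mulVec v = (lam : ℂ) • v ∧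
    ∀ (μ : ℝ) (w : ZMod d → ℂ), w ≠ 0 → M.mulVec w = (μ : ℂ) • w → μ ≤ lam

/-- `min_{θ ∈ [0, 2π]} ‖x - e^{iθ} y‖₂`. -/
def phaseDist {d : ℕ} [NeZero d] (x y : EuclideanSpace ℂ (ZMod d)) : ℝ :=
  ⨅ θ : Set.Icc (0 : ℝ) (2 * Real.pi), ‖x - Complex.exp (Complex.I * (θ : ℝ)) • y‖

/-- The infimum in `phaseDist` is attained, so it is a minimum. -/
theorem exists_phaseDist_eq {d : ℕ} [NeZero d] (x y : EuclideanSpace ℂ (ZMod d)) :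
    ∃ θ ∈ Set.Icc (0 : ℝ) (2 * Real.pi),
      ‖x - Complex.exp (Complex.I * (θ : ℝ)) • y‖ = phaseDist x y := by
  have hne : Nonempty (Set.Icc (0 : ℝ) (2 * Real.pi)) := ⟨⟨0, le_refl _, by positivity⟩⟩
  have hc : Continuous fun θ : Set.Icc (0 : ℝ) (2 * Real.pi) =>
      ‖x - Complex.exp (Complex.I * (θ : ℝ)) • y‖ := by fun_prop
  obtain ⟨θ, -, hθ⟩ := isCompact_univ.exists_isMinOn Set.univ_nonempty hc.continuousOn
  refine ⟨θ, θ.2, le_antisymm (le_ciInf fun t => hθ (Set.mem_univ t)) ?_⟩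
  exact ciInf_le ⟨0, by rintro _ ⟨t, rfl⟩; exact norm_nonneg _⟩ θ

/-- The signal-to-noise ratio `‖𝒜(X₀)‖₂ / ‖n‖₂` with `X₀ = T_{δ,s}(x₀ x₀*)`. -/
def snr (d δ s D : ℕ) [NeZero d] (m : Fin D → ZMod d → ℂ) (x₀ : ZMod d → ℂ)
    (n : EuclideanSpace ℝ (Fin (d / s) × Fin D)) : ℝ :=
  ‖measOp d s D m (bandProj d δ s (outer x₀))‖ / ‖n‖

end Ptycho

end

/-! The measurements see only the band, so with X₀ = T(x₀x₀*) the normal equations make 𝒜(X - X₀)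
the orthogonal projection of n onto the image of the band space. Hence σ_min ‖X - X₀‖_F ≤ ‖n‖
(`IsBandSolution.sigmaMin_mul_norm_sub_le`). Entrywise normalization costs a factor 2 / min|x₀|²
(`sum_norm_phaseMatrix_sub_sq_le`).

What remains is synchronization. Conjugating X̃ by the diagonal of g = sgn(x₀) gives a Hermitian E,
close to 1 on the band; let η be its squared Frobenius defect. The band graph is regular of some
degree K ≥ δ. Testing with the constant vector gives (K - λ)d ≤ η for the top eigenvalue λ, so the
eigenvector w with ‖w‖² = d has small twisted energy ∑|w_i - E_ik w_k|² ≤ 2η. If λ ≥ K/2, the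
eigenvalue equation also gives |w_i|² ≤ 4d/K; so E can be replaced by 1, and the plain energy is
O(dη/δ). A Poincaré inequality on the cycle with constant O(d²/δ³) (`sum_norm_sub_mean_sq_le_band`)
puts w within O(d³η/δ⁴) of its mean in squared norm, and rounding to unit modulus keeps this order.
If λ < K/2, then η is so large that the trivial bound suffices.

The resulting rate d^{3/2}/δ² is at most d²s/δ^{5/2} because δ ≤ d s². The second bound follows from
the first by ‖𝒜(X₀)‖ ≤ σ_max ‖X₀‖_F. -/

namespace Ptycho

/-! ### Extreme singular values as norm bounds -/

section SingularValues

variable {E F : Type*} [NormedAddCommGroup E] [InnerProductSpace ℂ E] [FiniteDimensional ℂ E]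
  [NormedAddCommGroup F] [InnerProductSpace ℂ F] [FiniteDimensional ℂ F]

/-- Diagonalize T*T: its eigenvalues are the squared singular values, and ‖T x‖² = ⟨x, T*T x⟩. -/
theorem norm_sq_apply_eq_sum_singularValues (T : E →ₗ[ℂ] F) (x : E) :
    ‖T x‖ ^ 2 = ∑ i : Fin (Module.finrank ℂ E), (T.singularValues i) ^ 2 *
      ‖(T.isSymmetric_adjoint_comp_self.eigenvectorBasis rfl).repr x i‖ ^ 2 := by
  set S := T.isSymmetric_adjoint_comp_self
  set b := S.eigenvectorBasis rfl with hb
  have h1 : inner ℂ x ((LinearMap.adjoint T ∘ₗ T) x) = (‖T x‖ : ℂ) ^ 2 := by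
    rw [LinearMap.comp_apply, LinearMap.adjoint_inner_right, inner_self_eq_norm_sq_to_K]
    rfl
  have h2 : inner ℂ x ((LinearMap.adjoint T ∘ₗ T) x) =
      ∑ i : Fin (Module.finrank ℂ E), (T.singularValues i : ℂ) ^ 2 * (‖b.repr x i‖ : ℂ) ^ 2 := by
    rw [← b.repr.inner_map_map, PiLp.inner_apply]
    refine Finset.sum_congr rfl fun i _ => ?_
    rw [hb, S.eigenvectorBasis_apply_self_apply rfl, ← hb, ← T.sq_singularValues_fin rfl]
    rw [← Complex.conj_mul']
    simp
    ring
  rw [h1] at h2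
  exact_mod_cast h2

theorem sigmaMin_mul_norm_le (T : E →ₗ[ℂ] F) (x : E) : sigmaMin T * ‖x‖ ≤ ‖T x‖ := by
  refine le_of_sq_le_sq ?_ (norm_nonneg _)
  rw [norm_sq_apply_eq_sum_singularValues, mul_pow,
    ← (T.isSymmetric_adjoint_comp_self.eigenvectorBasis rfl).repr.norm_map x,
    EuclideanSpace.norm_sq_eq, Finset.mul_sum]
  refine Finset.sum_le_sum fun i _ => mul_le_mul_of_nonneg_right ?_ (sq_nonneg _)
  refine pow_le_pow_left₀ (T.singularValues_nonneg _) ?_ 2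
  exact T.singularValues_antitone (by have := i.2; omega)

theorem norm_apply_le_sigmaMax_mul (T : E →ₗ[ℂ] F) (x : E) : ‖T x‖ ≤ sigmaMax T * ‖x‖ := by
  refine le_of_sq_le_sq ?_ (mul_nonneg (T.singularValues_nonneg _) (norm_nonneg _))
  rw [norm_sq_apply_eq_sum_singularValues, mul_pow,
    ← (T.isSymmetric_adjoint_comp_self.eigenvectorBasis rfl).repr.norm_map x,
    EuclideanSpace.norm_sq_eq, Finset.mul_sum]
  refine Finset.sum_le_sum fun i _ => mul_le_mul_of_nonneg_right ?_ (sq_nonneg _)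
  refine pow_le_pow_left₀ (T.singularValues_nonneg _) ?_ 2
  exact T.singularValues_antitone (Nat.zero_le _)

theorem sigmaMin_pos [Nontrivial E] {T : E →ₗ[ℂ] F} (hT : Function.Injective T) :
    0 < sigmaMin T := by
  refine T.injective_iff_forall_lt_finrank_singularValues_pos.mp hT _ ?_
  -- Nontriviality makes `finrank - 1` a genuine index rather than a truncated subtraction.
  have := Module.finrank_pos (R := ℂ) (M := E)
  omega

theorem sigmaMin_domRestrict_mul_norm_le (A : E →ₗ[ℂ] F) (p : Submodule ℂ E) {z : E}
    (hz : z ∈ p) : sigmaMin (E := p) (A.domRestrict p) * ‖z‖ ≤ ‖A z‖ :=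
  sigmaMin_mul_norm_le (A.domRestrict p) ⟨z, hz⟩

theorem norm_apply_le_sigmaMax_domRestrict_mul (A : E →ₗ[ℂ] F) (p : Submodule ℂ E) {z : E}
    (hz : z ∈ p) : ‖A z‖ ≤ sigmaMax (E := p) (A.domRestrict p) * ‖z‖ :=
  norm_apply_le_sigmaMax_mul (A.domRestrict p) ⟨z, hz⟩

theorem sigmaMin_domRestrict_pos {A : E →ₗ[ℂ] F} {p : Submodule ℂ E}
    (hA : Function.Injective (A.domRestrict p)) {z : E} (hz : z ∈ p) (hz0 : z ≠ 0) :
    0 < sigmaMin (E := p) (A.domRestrict p) := by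
  have : Nontrivial p := ⟨⟨z, hz⟩, 0, fun h => hz0 (congrArg Subtype.val h)⟩
  exact sigmaMin_pos hA

end SingularValues

open scoped ComplexOrder in
/-- The Rayleigh quotient of a Hermitian matrix is at most its largest eigenvalue. -/
theorem re_dotProduct_mulVec_le {ι : Type*} [Fintype ι] [DecidableEq ι] {M : Matrix ι ι ℂ}
    (hM : M.IsHermitian) {lam : ℝ}
    (hlam : ∀ (μ : ℝ) (w : ι → ℂ), w ≠ 0 → M.mulVec w = (μ : ℂ) • w → μ ≤ lam) (w : ι → ℂ) :
    (star w ⬝ᵥ M.mulVec w).re ≤ lam * ∑ i, ‖w i‖ ^ 2 := by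
  have hH : ((lam : ℂ) • (1 : Matrix ι ι ℂ) - M).IsHermitian := by
    refine Matrix.IsHermitian.sub ?_ hM
    simp [Matrix.IsHermitian, Matrix.conjTranspose_smul]
  -- An eigenvalue e of λ - M gives the eigenvalue λ - e of M, so λ - e ≤ λ and e ≥ 0.
  have hP : ((lam : ℂ) • (1 : Matrix ι ι ℂ) - M).PosSemidef := by
    rw [hH.posSemidef_iff_eigenvalues_nonneg]
    intro i
    have h := hH.mulVec_eigenvectorBasis i
    rw [Matrix.sub_mulVec, Matrix.smul_mulVec, Matrix.one_mulVec] at h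
    have := hlam (lam - hH.eigenvalues i) (hH.eigenvectorBasis i) ?_ ?_
    · simpa using this
    · intro h0
      apply (hH.eigenvectorBasis).toBasis.ne_zero i
      ext j
      simpa using congrFun h0 j
    · ext j
      have hj := congrFun h j
      simp only [Pi.sub_apply, Pi.smul_apply, smul_eq_mul, Complex.real_smul] at hj ⊢
      push_cast
      linear_combination -hj
  have h := (Complex.le_def.mp (hP.dotProduct_mulVec_nonneg w)).1
  rw [Matrix.sub_mulVec, Matrix.smul_mulVec, Matrix.one_mulVec, dotProduct_sub,
    dotProduct_smul] at h
  have h2 : star w ⬝ᵥ w = ((∑ i, ‖w i‖ ^ 2 : ℝ) : ℂ) := by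
    rw [dotProduct]
    push_cast
    exact Finset.sum_congr rfl fun i _ => by
      rw [← Complex.conj_mul']; rfl
  rw [h2, smul_eq_mul, ← Complex.ofReal_mul, Complex.sub_re, Complex.ofReal_re] at h
  simpa using h

/-! ### A Poincaré inequality on the cycle -/

section Poincare

variable {d : ℕ} [NeZero d]

/-- The `ℓ₂` norm of the difference of `w` and its translate by `k`. -/
noncomputable def translateDist (w : ZMod d → ℂ) (k : ZMod d) : ℝ :=
  ‖(WithLp.toLp 2 fun i => w (i + k) - w i : EuclideanSpace ℂ (ZMod d))‖

theorem translateDist_sq (w : ZMod d → ℂ) (k : ZMod d) :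
    translateDist w k ^ 2 = ∑ i, ‖w (i + k) - w i‖ ^ 2 := by
  rw [translateDist, EuclideanSpace.norm_sq_eq]

theorem translateDist_nonneg (w : ZMod d → ℂ) (k : ZMod d) : 0 ≤ translateDist w k :=
  norm_nonneg _

theorem translateDist_zero (w : ZMod d → ℂ) : translateDist w 0 = 0 := by
  rw [← sq_eq_zero_iff, translateDist_sq]
  simp

theorem translateDist_neg (w : ZMod d → ℂ) (k : ZMod d) :
    translateDist w (-k) = translateDist w k := by
  rw [← sq_eq_sq₀ (translateDist_nonneg _ _) (translateDist_nonneg _ _), translateDist_sq,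
    translateDist_sq, ← Equiv.sum_comp (Equiv.addRight k)]
  refine Finset.sum_congr rfl fun i _ => ?_
  simp [norm_sub_rev]

theorem translateDist_add_le (w : ZMod d → ℂ) (a b : ZMod d) :
    translateDist w (a + b) ≤ translateDist w a + translateDist w b := by
  have h : ‖(WithLp.toLp 2 fun i => w (i + a + b) - w (i + a) : EuclideanSpace ℂ (ZMod d))‖ =
      translateDist w b := by
    rw [← sq_eq_sq₀ (norm_nonneg _) (translateDist_nonneg _ _), EuclideanSpace.norm_sq_eq,
      translateDist_sq]
    exact Equiv.sum_comp (Equiv.addRight a) fun i => ‖w (i + b) - w i‖ ^ 2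
  rw [add_comm (translateDist w a), ← h]
  refine le_trans (le_of_eq ?_) (norm_add_le _ _)
  rw [translateDist]
  congr 1
  ext i
  simp [add_assoc]

theorem translateDist_nsmul_le (w : ZMod d → ℂ) (q : ℕ) (a : ZMod d) :
    translateDist w (q • a) ≤ q * translateDist w a := by
  induction q with
  | zero => simp [translateDist_zero]
  | succ q ih =>
    rw [succ_nsmul]
    refine (translateDist_add_le w _ _).trans ?_
    push_cast
    linarith

/-- A short translation is controlled by the average of the short translations. -/
theorem translateDist_sq_le_of_le (w : ZMod d → ℂ) {k m : ℕ} (hk : k ≤ m) :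
    translateDist w (k : ZMod d) ^ 2 ≤
      6 / (m + 1) * ∑ h ∈ Finset.range (m + 1), translateDist w (h : ZMod d) ^ 2 := by
  set G : ℕ → ℝ := fun h => translateDist w (h : ZMod d) ^ 2 with hG
  have hG0 : ∀ h, 0 ≤ G h := fun h => sq_nonneg _
  -- Translate by a, then by k - a, and later average over a. One of the two truncated differences
  -- is 0, where G vanishes, so adding both covers either sign; the three sums give 2 + 2 + 2 = 6.
  have hbd : ∀ a ∈ Finset.range (m + 1), G k ≤ 2 * G a + 2 * (G (a - k) + G (k - a)) := by
    intro a _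
    have hsq : ∀ x y z : ℝ, 0 ≤ x → x ≤ y + z → x ^ 2 ≤ 2 * y ^ 2 + 2 * z ^ 2 := by
      intro x y z hx h
      nlinarith [sq_nonneg (y - z), pow_le_pow_left₀ hx h 2]
    rcases le_total k a with h | h
    · have e : (k : ZMod d) = (a : ZMod d) + -((a - k : ℕ) : ZMod d) := by
        rw [Nat.cast_sub h]; ring
      have h1 := translateDist_add_le w (a : ZMod d) (-((a - k : ℕ) : ZMod d))
      rw [← e, translateDist_neg] at h1
      have := hsq _ _ _ (translateDist_nonneg _ _) h1
      have h0 := hG0 (k - a)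
      simp only [hG] at *
      linarith
    · have e : (k : ZMod d) = (a : ZMod d) + ((k - a : ℕ) : ZMod d) := by
        rw [Nat.cast_sub h]; ring
      have h1 := translateDist_add_le w (a : ZMod d) ((k - a : ℕ) : ZMod d)
      rw [← e] at h1
      have := hsq _ _ _ (translateDist_nonneg _ _) h1
      have h0 := hG0 (a - k)
      simp only [hG] at *
      linarith
  have hG00 : G 0 = 0 := by simp [hG, translateDist_zero]
  set total := ∑ h ∈ Finset.range (m + 1), G h with hS
  have hsplit : m + 1 = k + (m + 1 - k) := by omega
  have h1 : ∑ a ∈ Finset.range (m + 1), G (a - k) ≤ total := by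
    rw [hsplit, Finset.sum_range_add]
    have z : ∑ x ∈ Finset.range k, G (x - k) = 0 := by
      refine Finset.sum_eq_zero fun x hx => ?_
      rw [Finset.mem_range] at hx
      rw [show x - k = 0 by omega, hG00]
    rw [z, zero_add]
    simp only [Nat.add_sub_cancel_left]
    exact Finset.sum_le_sum_of_subset_of_nonneg
      (Finset.range_subset_range.mpr (by omega)) fun _ _ _ => hG0 _
  have h2 : ∑ a ∈ Finset.range (m + 1), G (k - a) ≤ total := by
    have hsplit' : m + 1 = (k + 1) + (m - k) := by omega
    rw [hsplit', Finset.sum_range_add]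
    have z : ∑ x ∈ Finset.range (m - k), G (k - (k + 1 + x)) = 0 := by
      refine Finset.sum_eq_zero fun x hx => ?_
      rw [show k - (k + 1 + x) = 0 by omega, hG00]
    rw [z, add_zero]
    have hr := Finset.sum_range_reflect G (k + 1)
    simp only [Nat.add_sub_cancel] at hr
    rw [hr]
    exact Finset.sum_le_sum_of_subset_of_nonneg
      (Finset.range_subset_range.mpr (by omega)) fun _ _ _ => hG0 _
  have h3 := Finset.sum_le_sum hbd
  rw [Finset.sum_const, Finset.card_range, Finset.sum_add_distrib, ← Finset.mul_sum,
    ← Finset.mul_sum, Finset.sum_add_distrib, nsmul_eq_mul] at h3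
  push_cast at h3
  have hm : (0 : ℝ) < m + 1 := by positivity
  rw [div_mul_eq_mul_div, le_div_iff₀ hm]
  change G k * _ ≤ 6 * total
  nlinarith

/-- A Poincaré inequality on the cycle, for the graph joining points at distance at most `m`. -/
theorem sum_norm_sub_mean_sq_le (w : ZMod d → ℂ) {m : ℕ} (hm : 0 < m) :
    ∑ i, ‖w i - (d : ℂ)⁻¹ * ∑ j, w j‖ ^ 2 ≤
      ((d : ℝ) / m + 1) ^ 2 * (6 / (m + 1) *
        ∑ h ∈ Finset.range (m + 1), ∑ i, ‖w (i + (h : ZMod d)) - w i‖ ^ 2) := by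
  have hd : (0 : ℝ) < d := by exact_mod_cast NeZero.pos d
  set B : ℝ := 6 / (m + 1) *
        ∑ h ∈ Finset.range (m + 1), ∑ i, ‖w (i + (h : ZMod d)) - w i‖ ^ 2 with hB
  have hB0 : 0 ≤ B := by positivity
  have hshort : ∀ k : ℕ, k ≤ m → translateDist w (k : ZMod d) ≤ √B := fun k hk => by
    refine Real.le_sqrt_of_sq_le ?_
    have := translateDist_sq_le_of_le w hk
    simpa only [translateDist_sq] using this
  -- Write k = qm + r with q ≤ d/m: at most d/m translations by m and one by r < m.
  have hall : ∀ k : ZMod d, translateDist w k ^ 2 ≤ ((d : ℝ) / m + 1) ^ 2 * B := fun k => by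
    rw [← Real.sq_sqrt hB0, ← mul_pow]
    refine pow_le_pow_left₀ (translateDist_nonneg _ _) ?_ 2
    have e : k = (k.val / m) • (m : ZMod d) + ((k.val % m : ℕ) : ZMod d) := by
      rw [nsmul_eq_mul, ← Nat.cast_mul, ← Nat.cast_add, Nat.div_add_mod', ZMod.natCast_zmod_val]
    have h1 := translateDist_add_le w ((k.val / m) • (m : ZMod d)) ((k.val % m : ℕ) : ZMod d)
    rw [← e] at h1
    have h2 := translateDist_nsmul_le w (k.val / m) (m : ZMod d)
    have h3 := hshort m le_rfl
    have h4 := hshort _ (Nat.mod_lt k.val hm).le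
    have h5 : ((k.val / m : ℕ) : ℝ) ≤ d / m := by
      refine Nat.cast_div_le.trans ?_
      gcongr
      exact (ZMod.val_lt k).le
    have h6 := mul_le_mul h5 h3 (translateDist_nonneg _ _) (by positivity)
    linarith
  -- The deviation from the mean is, up to sign, the average of the differences over all
  -- translations; apply Cauchy–Schwarz.
  have hpt : ∀ i, ‖w i - (d : ℂ)⁻¹ * ∑ j, w j‖ ^ 2 ≤ (d : ℝ)⁻¹ * ∑ k, ‖w (i + k) - w i‖ ^ 2 := by
    intro i
    have hd' : (d : ℂ) ≠ 0 := by exact_mod_cast NeZero.ne d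
    have e : w i - (d : ℂ)⁻¹ * ∑ j, w j = -((d : ℂ)⁻¹ * ∑ k, (w (i + k) - w i)) := by
      have hshift : ∑ k, w (i + k) = ∑ j, w j := Equiv.sum_comp (Equiv.addLeft i) w
      rw [Finset.sum_sub_distrib, hshift]
      simp [ZMod.card]
      field_simp
      ring
    rw [e, norm_neg, norm_mul, norm_inv, Complex.norm_natCast, mul_pow, sq (d : ℝ)⁻¹, mul_assoc]
    refine mul_le_mul_of_nonneg_left ?_ (by positivity)
    rw [inv_mul_le_iff₀ hd]
    have h1 := norm_sum_le Finset.univ fun k => w (i + k) - w i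
    have h2 := sq_sum_le_card_mul_sum_sq (s := Finset.univ) (f := fun k => ‖w (i + k) - w i‖)
    simp only [Finset.card_univ, ZMod.card] at h2
    exact (pow_le_pow_left₀ (norm_nonneg _) h1 2).trans h2
  calc _ ≤ ∑ i, (d : ℝ)⁻¹ * ∑ k, ‖w (i + k) - w i‖ ^ 2 := Finset.sum_le_sum fun i _ => hpt i
    _ = (d : ℝ)⁻¹ * ∑ k, translateDist w k ^ 2 := by
      rw [← Finset.mul_sum, Finset.sum_comm]
      simp only [translateDist_sq]
    _ ≤ (d : ℝ)⁻¹ * ∑ _k : ZMod d, ((d : ℝ) / m + 1) ^ 2 * B := by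
      gcongr with k
      exact hall k
    _ = _ := by
      simp [ZMod.card]
      field_simp

end Poincare

/-! ### Combinatorics of the band graph -/

section Band

variable {d δ s : ℕ}

/-- `i` lies in the index block `{sℓ, …, sℓ+δ-1}` modulo `d`. -/
def InBlock (d δ s ℓ : ℕ) (i : ZMod d) : Prop := ∃ a < δ, i = ((s * ℓ + a : ℕ) : ZMod d)

/-- Since s · (d/s) = d, block positions are periodic in ℓ; block indices may then be arbitrary
naturals. -/
theorem inBlock_mod (hsd : s ∣ d) (ℓ : ℕ) (i : ZMod d) :
    InBlock d δ s (ℓ % (d / s)) i ↔ InBlock d δ s ℓ i := by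
  have e : ((s * ℓ : ℕ) : ZMod d) = ((s * (ℓ % (d / s)) : ℕ) : ZMod d) := by
    conv_lhs => rw [← Nat.div_add_mod ℓ (d / s), mul_add, ← mul_assoc, Nat.mul_div_cancel' hsd]
    push_cast
    simp
  simp only [InBlock, Nat.cast_add, e]

theorem inBand_comm (i k : ZMod d) : InBand d δ s i k ↔ InBand d δ s k i := by
  constructor <;> rintro ⟨ℓ, hℓ, a, ha, b, hb, hi, hk⟩ <;> exact ⟨ℓ, hℓ, b, hb, a, ha, hk, hi⟩

theorem inBlock_add (g ℓ : ℕ) (i : ZMod d) (h : InBlock d δ s ℓ i) :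
    InBlock d δ s (ℓ + g) (i + (s * g : ℕ)) := by
  obtain ⟨a, ha, rfl⟩ := h
  exact ⟨a, ha, by push_cast; ring⟩

/-- Blocks start and end at multiples of s, also modulo d, so each is a union of cells {sg, …, sg +
s - 1}. -/
theorem inBlock_add_small_iff (hsδ : s ∣ δ) (hsd : s ∣ d) (ℓ g : ℕ) {r : ℕ} (hr : r < s) :
    InBlock d δ s ℓ ((s * g + r : ℕ) : ZMod d) ↔ InBlock d δ s ℓ ((s * g : ℕ) : ZMod d) := by
  constructor
  · rintro ⟨a, ha, h⟩
    have hmod : r = a % s := by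
      have h1 : s * g + r ≡ s * ℓ + a [MOD s] :=
        ((ZMod.natCast_eq_natCast_iff _ _ _).mp h).of_dvd hsd
      have h2 : (s * g + r) % s = (s * ℓ + a) % s := h1
      rwa [Nat.mul_add_mod, Nat.mul_add_mod, Nat.mod_eq_of_lt hr] at h2
    refine ⟨a - r, by omega, ?_⟩
    have hra : r ≤ a := hmod ▸ Nat.mod_le a s
    have e : s * ℓ + a = s * ℓ + (a - r) + r := by omega
    rw [e, Nat.cast_add, Nat.cast_add (s * ℓ + (a - r))] at h
    exact add_right_cancel h
  · rintro ⟨a, ha, h⟩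
    have hmod : s ∣ a := by
      have h1 : s * g ≡ s * ℓ + a [MOD s] :=
        ((ZMod.natCast_eq_natCast_iff _ _ _).mp h).of_dvd hsd
      have h2 : (s * g) % s = (s * ℓ + a) % s := h1
      rw [Nat.mul_add_mod, Nat.mul_mod_right] at h2
      exact Nat.dvd_of_mod_eq_zero h2.symm
    obtain ⟨t, rfl⟩ := hsδ
    obtain ⟨a', rfl⟩ := hmod
    refine ⟨s * a' + r, ?_, ?_⟩
    · have : a' + 1 ≤ t := Nat.lt_of_mul_lt_mul_left ha
      nlinarith
    · rw [Nat.cast_add, h, ← Nat.cast_add, add_assoc]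

variable [NeZero d]

theorem inBand_iff_exists_inBlock (hsd : s ∣ d) (i k : ZMod d) :
    InBand d δ s i k ↔ ∃ ℓ, InBlock d δ s ℓ i ∧ InBlock d δ s ℓ k := by
  constructor
  · rintro ⟨ℓ, _, a, ha, b, hb, hi, hk⟩
    exact ⟨ℓ, ⟨a, ha, hi⟩, ⟨b, hb, hk⟩⟩
  · rintro ⟨ℓ, hi, hk⟩
    have hpos : 0 < d / s := Nat.div_pos (Nat.le_of_dvd (NeZero.pos d) hsd)
      (Nat.pos_of_dvd_of_pos hsd (NeZero.pos d))
    obtain ⟨a, ha, hi⟩ := (inBlock_mod hsd ℓ i).mpr hi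
    obtain ⟨b, hb, hk⟩ := (inBlock_mod hsd ℓ k).mpr hk
    exact ⟨_, Nat.mod_lt _ hpos, a, ha, b, hb, hi, hk⟩

theorem inBand_add_of_inBand (hsd : s ∣ d) (g : ℕ) {i k : ZMod d} (h : InBand d δ s i k) :
    InBand d δ s (i + (s * g : ℕ)) (k + (s * g : ℕ)) := by
  rw [inBand_iff_exists_inBlock hsd] at h ⊢
  obtain ⟨ℓ, hi, hk⟩ := h
  exact ⟨ℓ + g, inBlock_add g ℓ i hi, inBlock_add g ℓ k hk⟩

theorem inBand_add_iff (hsd : s ∣ d) (g : ℕ) (i k : ZMod d) :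
    InBand d δ s (i + (s * g : ℕ)) (k + (s * g : ℕ)) ↔ InBand d δ s i k := by
  refine ⟨fun h => ?_, inBand_add_of_inBand hsd g⟩
  -- The inverse translation, written as a forward translation by a multiple of s.
  have e : ∀ j : ZMod d, j + (s * g : ℕ) + (s * ((d / s - 1) * g) : ℕ) = j := by
    intro j
    have hpos : 1 ≤ d / s := Nat.div_pos (Nat.le_of_dvd (NeZero.pos d) hsd)
      (Nat.pos_of_dvd_of_pos hsd (NeZero.pos d))
    rw [add_assoc, ← Nat.cast_add]
    have : s * g + s * ((d / s - 1) * g) = d * g := by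
      rw [← mul_add, ← one_add_mul, Nat.add_sub_cancel' hpos, ← mul_assoc,
        Nat.mul_div_cancel' hsd]
    rw [this]
    simp
  simpa only [e] using inBand_add_of_inBand hsd ((d / s - 1) * g) h

open Classical in
/-- The number of entries in each row of the band. -/
noncomputable def bandDegree (d δ s : ℕ) [NeZero d] : ℕ :=
  (Finset.univ.filter fun k : ZMod d => InBand d δ s 0 k).card

-- Regularity of the graph: replace i by the start of its cell, then translate by a multiple of s to
-- 0.
open Classical in
theorem card_filter_inBand (hsδ : s ∣ δ) (hsd : s ∣ d) (i : ZMod d) :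
    (Finset.univ.filter fun k => InBand d δ s i k).card = bandDegree d δ s := by
  have hs : 0 < s := Nat.pos_of_dvd_of_pos hsd (NeZero.pos d)
  set g := i.val / s
  have hi : i = ((s * g + i.val % s : ℕ) : ZMod d) := by
    rw [Nat.div_add_mod, ZMod.natCast_zmod_val]
  have h1 : ∀ k, InBand d δ s i k ↔ InBand d δ s ((s * g : ℕ) : ZMod d) k := by
    intro k
    rw [hi, inBand_iff_exists_inBlock hsd, inBand_iff_exists_inBlock hsd]
    simp only [inBlock_add_small_iff hsδ hsd _ g (Nat.mod_lt i.val hs)]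
  simp only [h1]
  symm
  refine Finset.card_bij (fun k _ => k + (s * g : ℕ)) ?_ ?_ ?_
  · intro k hk
    rw [Finset.mem_filter] at hk ⊢
    refine ⟨Finset.mem_univ _, ?_⟩
    have := (inBand_add_iff hsd g 0 k).mpr hk.2
    rwa [zero_add] at this
  · intro a _ b _ h
    exact add_right_cancel h
  · intro k hk
    refine ⟨k - (s * g : ℕ), ?_, sub_add_cancel _ _⟩
    rw [Finset.mem_filter] at hk ⊢
    refine ⟨Finset.mem_univ _, (inBand_add_iff hsd g _ _).mp ?_⟩
    rw [zero_add, sub_add_cancel]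
    exact hk.2

/-- In the block starting at the cell of i, the offset of i is at most s - 1, which leaves room for
δ - s further steps. -/
theorem inBand_add_natCast (hsδ : s ∣ δ) (hsd : s ∣ d) (i : ZMod d) {h : ℕ}
    (hδ : 0 < δ) (hh : h ≤ δ - s) : InBand d δ s i (i + (h : ZMod d)) := by
  have hs : 0 < s := Nat.pos_of_dvd_of_pos hsd (NeZero.pos d)
  have hle := Nat.le_of_dvd hδ hsδ
  have hr := Nat.mod_lt i.val hs
  have hi : i = ((s * (i.val / s) + i.val % s : ℕ) : ZMod d) := by
    rw [Nat.div_add_mod, ZMod.natCast_zmod_val]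
  rw [inBand_iff_exists_inBlock hsd]
  refine ⟨i.val / s, ⟨i.val % s, by omega, hi⟩, ⟨i.val % s + h, by omega, ?_⟩⟩
  conv_lhs => rw [hi]
  push_cast
  ring

theorem inBand_self (hsδ : s ∣ δ) (hsd : s ∣ d) (hδ : 0 < δ) (i : ZMod d) :
    InBand d δ s i i := by
  simpa using inBand_add_natCast hsδ hsd i (h := 0) hδ (Nat.zero_le _)

theorem le_bandDegree (hsd : s ∣ d) (hδd : δ ≤ d) : δ ≤ bandDegree d δ s := by
  classical
  rw [bandDegree]
  refine (Finset.card_range δ).ge.trans (Finset.card_le_card_of_injOn (fun a : ℕ => (a : ZMod d)) ?_ ?_)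
  · intro a ha
    have ha' : a < δ := by simpa using ha
    simp only [Finset.coe_filter, Finset.mem_univ, true_and, Set.mem_ofPred_eq]
    rw [inBand_iff_exists_inBlock hsd]
    exact ⟨0, ⟨0, by omega, by simp⟩, ⟨a, ha', by simp⟩⟩
  · intro a ha b hb h
    have ha' : a < δ := by simpa using ha
    have hb' : b < δ := by simpa using hb
    have := (ZMod.natCast_eq_natCast_iff' _ _ _).mp h
    rwa [Nat.mod_eq_of_lt (by omega), Nat.mod_eq_of_lt (by omega)] at this

end Band

/-! ### Stability of normalization and rounding -/

/-- Normalization is stable: `y` is the normalization of `z`, or any point of the unit disc if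
`z = 0`. -/
theorem norm_normalize_sub_le {y z w : ℂ} (hw : w ≠ 0) (hy : ‖y‖ ≤ 1)
    (hyz : z ≠ 0 → y = z / (‖z‖ : ℂ)) : ‖y - w / (‖w‖ : ℂ)‖ ≤ 2 * ‖z - w‖ / ‖w‖ := by
  have hwn : 0 < ‖w‖ := norm_pos_iff.mpr hw
  have hwc : (‖w‖ : ℂ) ≠ 0 := by exact_mod_cast hwn.ne'
  by_cases hz : z = 0
  · rw [hz, zero_sub, norm_neg, mul_div_assoc, div_self hwn.ne', mul_one]
    refine (norm_sub_le _ _).trans ?_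
    rw [norm_div, Complex.norm_real, norm_norm, div_self hwn.ne']
    linarith
  · have hzn : 0 < ‖z‖ := norm_pos_iff.mpr hz
    have hzc : (‖z‖ : ℂ) ≠ 0 := by exact_mod_cast hzn.ne'
    rw [hyz hz, le_div_iff₀ hwn]
    -- Both summands on the right have norm at most ‖z - w‖, whence the factor 2.
    have e : ‖z / (‖z‖ : ℂ) - w / (‖w‖ : ℂ)‖ * ‖w‖ =
        ‖(z - w) + z / (‖z‖ : ℂ) * ((‖w‖ - ‖z‖ : ℝ) : ℂ)‖ := by
      conv_lhs => rw [← norm_norm w, ← Complex.norm_real ‖w‖, ← norm_mul]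
      congr 1
      push_cast
      simp only [norm_norm, Complex.norm_real]
      field_simp
      ring
    rw [e]
    refine (norm_add_le _ _).trans ?_
    rw [norm_mul, norm_div, Complex.norm_real, norm_norm, div_self hzn.ne', one_mul,
      Complex.norm_real, Real.norm_eq_abs]
    have := abs_norm_sub_norm_le w z
    rw [norm_sub_rev] at this
    linarith

/-- Rounding a vector that is close to a constant to entries of modulus one. -/
theorem exists_sum_norm_one_sub_mul_sq_le {ι : Type*} [Fintype ι] (w y : ι → ℂ) (μ : ℂ)
    (hw : ∑ i, ‖w i‖ ^ 2 = Fintype.card ι) (hy : ∀ i, ‖y i‖ ≤ 1)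
    (hyw : ∀ i, w i ≠ 0 → y i = w i / (‖w i‖ : ℂ)) :
    ∃ φ : ℂ, ‖φ‖ = 1 ∧ ∑ i, ‖1 - φ * y i‖ ^ 2 ≤ 16 * ∑ i, ‖w i - μ‖ ^ 2 := by
  -- For large μ, align with the phase of μ: the loss is 2/‖μ‖ ≤ 4, squared 16.
  by_cases hμ : 1 / 2 ≤ ‖μ‖
  · have hn : 0 < ‖μ‖ := by linarith
    have hμ0 : μ ≠ 0 := norm_pos_iff.mp hn
    have hu : ‖μ / (‖μ‖ : ℂ)‖ = 1 := by
      rw [norm_div, Complex.norm_real, norm_norm, div_self hn.ne']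
    refine ⟨(μ / (‖μ‖ : ℂ))⁻¹, by rw [norm_inv, hu, inv_one], ?_⟩
    rw [Finset.mul_sum]
    refine Finset.sum_le_sum fun i _ => ?_
    have h0 : μ / (‖μ‖ : ℂ) ≠ 0 := by
      intro h
      rw [h, norm_zero] at hu
      exact zero_ne_one hu
    have e : ‖1 - (μ / (‖μ‖ : ℂ))⁻¹ * y i‖ = ‖y i - μ / (‖μ‖ : ℂ)‖ := by
      rw [← one_mul ‖1 - _‖, ← hu, ← norm_mul, mul_sub, mul_inv_cancel_left₀ h0, mul_one,
        norm_sub_rev]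
    have h1 := norm_normalize_sub_le hμ0 (hy i) (hyw i)
    have h2 : 2 * ‖w i - μ‖ / ‖μ‖ ≤ 4 * ‖w i - μ‖ := by
      rw [div_le_iff₀ hn]
      nlinarith [norm_nonneg (w i - μ)]
    rw [e]
    have := pow_le_pow_left₀ (norm_nonneg _) (h1.trans h2) 2
    linarith
  -- For small μ, ‖w i‖² ≤ 2‖w i - μ‖² + 1/2 sums to ∑‖w i - μ‖² ≥ N/4 with N = `Fintype.card ι`, so
  -- the trivial bound 4N is enough.
  · push Not at hμ
    refine ⟨1, norm_one, ?_⟩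
    have h1 : ∀ i, ‖1 - 1 * y i‖ ^ 2 ≤ 4 := fun i => by
      have : ‖1 - 1 * y i‖ ≤ 2 := by
        rw [one_mul]
        refine (norm_sub_le _ _).trans ?_
        rw [norm_one]
        linarith [hy i]
      nlinarith [norm_nonneg (1 - 1 * y i)]
    have h2 : ∀ i, ‖w i‖ ^ 2 ≤ 2 * ‖w i - μ‖ ^ 2 + 1 / 2 := fun i => by
      have h := norm_add_le (w i - μ) μ
      rw [sub_add_cancel] at h
      have h' := pow_le_pow_left₀ (norm_nonneg _) h 2
      nlinarith [sq_nonneg (‖w i - μ‖ - ‖μ‖), norm_nonneg μ]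
    have h3 := Finset.sum_le_sum fun i (_ : i ∈ Finset.univ) => h2 i
    have h4 := Finset.sum_le_sum fun i (_ : i ∈ Finset.univ) => h1 i
    rw [Finset.sum_add_distrib, ← Finset.mul_sum, hw] at h3
    simp only [Finset.sum_const, Finset.card_univ, nsmul_eq_mul] at h3 h4
    linarith

/-! ### Angular synchronization on the band graph -/

section Synchronization

variable {d δ s : ℕ} [NeZero d]

open Classical in
/-- The neighbours of `i` in the band graph. -/
noncomputable def bandNeighbors (d δ s : ℕ) [NeZero d] (i : ZMod d) : Finset (ZMod d) :=
  Finset.univ.filter fun k => InBand d δ s i k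

theorem mem_bandNeighbors {i k : ZMod d} : k ∈ bandNeighbors d δ s i ↔ InBand d δ s i k := by
  simp [bandNeighbors]

theorem card_bandNeighbors (hsδ : s ∣ δ) (hsd : s ∣ d) (i : ZMod d) :
    (bandNeighbors d δ s i).card = bandDegree d δ s :=
  card_filter_inBand hsδ hsd i

theorem sum_bandNeighbors_comm {α : Type*} [AddCommMonoid α] (f : ZMod d → ZMod d → α) :
    ∑ i, ∑ k ∈ bandNeighbors d δ s i, f i k = ∑ k, ∑ i ∈ bandNeighbors d δ s k, f i k := by
  refine Finset.sum_comm' fun i k => ?_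
  simp only [mem_bandNeighbors, Finset.mem_univ, true_and, and_true]
  exact inBand_comm i k

theorem sum_bandNeighbors_eq {α : Type*} [AddCommMonoid α] {f : ZMod d → α} {i : ZMod d}
    (hf : ∀ k, ¬ InBand d δ s i k → f k = 0) : ∑ k ∈ bandNeighbors d δ s i, f k = ∑ k, f k := by
  refine Finset.sum_subset (Finset.subset_univ _) fun k _ hk => hf k ?_
  rwa [mem_bandNeighbors] at hk

theorem sum_translates_le (hsδ : s ∣ δ) (hsd : s ∣ d) (hδ : 0 < δ) (hδd : δ < d)
    (w : ZMod d → ℂ) :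
    ∑ h ∈ Finset.range (δ - s + 1), ∑ i, ‖w (i + (h : ZMod d)) - w i‖ ^ 2 ≤
      ∑ i, ∑ k ∈ bandNeighbors d δ s i, ‖w k - w i‖ ^ 2 := by
  rw [Finset.sum_comm]
  refine Finset.sum_le_sum fun i _ => ?_
  have hinj : Set.InjOn (fun h : ℕ => i + (h : ZMod d)) (Finset.range (δ - s + 1)) := by
    intro a ha b hb h
    have ha' : a < δ - s + 1 := by simpa using ha
    have hb' : b < δ - s + 1 := by simpa using hb
    have := (ZMod.natCast_eq_natCast_iff' _ _ _).mp (add_left_cancel h)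
    rwa [Nat.mod_eq_of_lt (by omega), Nat.mod_eq_of_lt (by omega)] at this
  rw [← Finset.sum_image (f := fun k => ‖w k - w i‖ ^ 2) hinj]
  refine Finset.sum_le_sum_of_subset_of_nonneg ?_ fun _ _ _ => sq_nonneg _
  intro k hk
  obtain ⟨h, hh, rfl⟩ := Finset.mem_image.mp hk
  rw [Finset.mem_range] at hh
  exact mem_bandNeighbors.mpr (inBand_add_natCast hsδ hsd i hδ (by omega))

/-- A proper divisor satisfies s ≤ δ/2, so m = δ - s ≥ δ/2 in the cycle inequality; the constant is
3² · 12 = 108. -/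
theorem sum_norm_sub_mean_sq_le_band (hsδ : s ∣ δ) (hsd : s ∣ d) (hsl : s < δ) (hδd : δ < d)
    (w : ZMod d → ℂ) :
    ∑ i, ‖w i - (d : ℂ)⁻¹ * ∑ j, w j‖ ^ 2 ≤
      108 * ((d : ℝ) ^ 2 / (δ : ℝ) ^ 3) *
        ∑ i, ∑ k ∈ bandNeighbors d δ s i, ‖w k - w i‖ ^ 2 := by
  have hδ : 0 < δ := by omega
  have hT := sum_translates_le hsδ hsd hδ hδd w
  have hδR : (0 : ℝ) < δ := by exact_mod_cast hδ
  have hdR : (δ : ℝ) < d := by exact_mod_cast hδd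
  have hd0 : (0 : ℝ) < d := hδR.trans hdR
  have hm : 0 < δ - s := by omega
  have hmR : (δ : ℝ) / 2 ≤ ((δ - s : ℕ) : ℝ) := by
    obtain ⟨t, rfl⟩ := hsδ
    have ht : 1 < t := by
      by_contra hc
      have : s * t ≤ s * 1 := Nat.mul_le_mul_left s (by omega)
      omega
    have : s * 2 ≤ s * t := Nat.mul_le_mul_left s ht
    rw [div_le_iff₀ two_pos]
    exact_mod_cast (by omega : s * t ≤ (s * t - s) * 2)
  have hP := sum_norm_sub_mean_sq_le w hm
  generalize ((δ - s : ℕ) : ℝ) = m at hP hmR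
  have hm0 : 0 < m := by linarith
  have hone : 1 ≤ (d : ℝ) / δ := by
    rw [le_div_iff₀ hδR]
    linarith
  have hc1 : (d : ℝ) / m + 1 ≤ 3 * (d / δ) := by
    have : (d : ℝ) / m ≤ d / (δ / 2) :=
      div_le_div_of_nonneg_left hd0.le (by positivity) hmR
    have e : (d : ℝ) / (δ / 2) = 2 * (d / δ) := by field_simp
    linarith
  have hc2 : (6 : ℝ) / (m + 1) ≤ 12 / δ := by
    have : (6 : ℝ) / (m + 1) ≤ 6 / (δ / 2) :=
      div_le_div_of_nonneg_left (by norm_num) (by positivity) (by linarith)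
    have e : (6 : ℝ) / (δ / 2) = 12 / δ := by field_simp; norm_num
    linarith
  refine hP.trans ?_
  have hc3 : ((d : ℝ) / m + 1) ^ 2 ≤ (3 * (d / δ)) ^ 2 :=
    pow_le_pow_left₀ (by positivity) hc1 2
  have hA : 0 ≤ ∑ h ∈ Finset.range (δ - s + 1), ∑ i, ‖w (i + (h : ZMod d)) - w i‖ ^ 2 := by
    positivity
  have h1 := mul_le_mul hc2 hT hA (by positivity)
  have h2 := mul_le_mul hc3 h1 (mul_nonneg (by positivity) hA) (by positivity)
  refine h2.trans (le_of_eq ?_)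
  field_simp
  ring

theorem norm_sub_mul_sq_le (a b e : ℂ) (he : ‖e‖ ≤ 1) :
    ‖a - e * b‖ ^ 2 ≤ ‖a‖ ^ 2 + ‖b‖ ^ 2 - 2 * (star a * (e * b)).re := by
  have h := norm_sub_sq (𝕜 := ℂ) a (e * b)
  have h2 : RCLike.re (inner ℂ a (e * b)) = (star a * (e * b)).re := by
    simp [mul_comm]
  rw [h, h2, norm_mul, mul_pow]
  have : ‖e‖ ^ 2 ≤ 1 := pow_le_one₀ (norm_nonneg _) he
  nlinarith [sq_nonneg ‖b‖]

/-- For unit e one has the sharper Re e = 1 - ‖1 - e‖²/2; dropping the factor 1/2 also covers e = 0,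
an entry with sgn 0 = 0. -/
theorem one_sub_norm_sq_le_re {e : ℂ} (he : ‖e‖ = 1 ∨ e = 0) : 1 - ‖1 - e‖ ^ 2 ≤ e.re := by
  rcases he with he | rfl
  · have h := norm_sub_sq (𝕜 := ℂ) 1 e
    have h2 : RCLike.re (inner ℂ 1 e) = e.re := by simp
    rw [h2, he, norm_one] at h
    have h3 := Complex.re_le_norm e
    linarith
  · simp

section Estimate

variable {E : ZMod d → ZMod d → ℂ} {w : ZMod d → ℂ} {lam : ℝ}

/-- The defect of a connection on the band graph, in the Frobenius norm. -/
noncomputable def bandDefect (d δ s : ℕ) [NeZero d] (E : ZMod d → ZMod d → ℂ) : ℝ :=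
  ∑ i, ∑ k ∈ bandNeighbors d δ s i, ‖1 - E i k‖ ^ 2

theorem degree_sub_mul_le_bandDefect (hsδ : s ∣ δ) (hsd : s ∣ d)
    (hE0 : ∀ i k, ¬ InBand d δ s i k → E i k = 0)
    (hE1 : ∀ i k, ‖E i k‖ = 1 ∨ E i k = 0)
    (hR : (∑ i, ∑ k, E i k).re ≤ lam * d) :
    (bandDegree d δ s - lam) * d ≤ bandDefect d δ s E := by
  have h1 : ∑ i : ZMod d, ∑ k ∈ bandNeighbors d δ s i, (1 - ‖1 - E i k‖ ^ 2) ≤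
      (∑ i, ∑ k, E i k).re := by
    rw [Complex.re_sum]
    refine Finset.sum_le_sum fun i _ => ?_
    rw [← sum_bandNeighbors_eq (hE0 i), Complex.re_sum]
    exact Finset.sum_le_sum fun k _ => one_sub_norm_sq_le_re (hE1 i k)
  simp only [Finset.sum_sub_distrib, Finset.sum_const, card_bandNeighbors hsδ hsd,
    Finset.card_univ, ZMod.card, nsmul_eq_mul, mul_one] at h1
  rw [bandDefect]
  linarith

/-- Expand the squares, with K the degree: by regularity each diagonal sum is Kd, and by the
eigenvalue equation the cross term is λd. -/
theorem sum_norm_sub_mul_sq_le (hsδ : s ∣ δ) (hsd : s ∣ d)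
    (hE0 : ∀ i k, ¬ InBand d δ s i k → E i k = 0)
    (hE1 : ∀ i k, ‖E i k‖ = 1 ∨ E i k = 0)
    (heig : ∀ i, ∑ k, E i k * w k = lam * w i) (hw : ∑ i, ‖w i‖ ^ 2 = d) :
    ∑ i, ∑ k ∈ bandNeighbors d δ s i, ‖w i - E i k * w k‖ ^ 2 ≤
      2 * ((bandDegree d δ s - lam) * d) := by
  have hE : ∀ i k, ‖E i k‖ ≤ 1 := fun i k => by
    rcases hE1 i k with h | h <;> simp [h]
  have h1 := Finset.sum_le_sum fun i (_ : i ∈ Finset.univ) =>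
    Finset.sum_le_sum fun k (_ : k ∈ bandNeighbors d δ s i) =>
      norm_sub_mul_sq_le (w i) (w k) (E i k) (hE i k)
  refine h1.trans (le_of_eq ?_)
  have hA : ∑ i, ∑ _k ∈ bandNeighbors d δ s i, ‖w i‖ ^ 2 = bandDegree d δ s * d := by
    simp only [Finset.sum_const, card_bandNeighbors hsδ hsd, nsmul_eq_mul]
    rw [← Finset.mul_sum, hw]
  have hB : ∑ i, ∑ k ∈ bandNeighbors d δ s i, ‖w k‖ ^ 2 = bandDegree d δ s * d := by
    rw [sum_bandNeighbors_comm]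
    exact hA
  have hC : ∑ i, ∑ k ∈ bandNeighbors d δ s i, (star (w i) * (E i k * w k)).re = lam * d := by
    rw [← hw, Finset.mul_sum]
    refine Finset.sum_congr rfl fun i _ => ?_
    rw [← Complex.re_sum, ← Finset.mul_sum,
      sum_bandNeighbors_eq (fun k hk => by rw [hE0 i k hk, zero_mul]), heig i]
    have : star (w i) * (lam * w i) = ((lam * ‖w i‖ ^ 2 : ℝ) : ℂ) := by
      push_cast
      rw [← Complex.conj_mul']
      simp only [RCLike.star_def]
      ring
    rw [this, Complex.ofReal_re]
  simp only [Finset.sum_sub_distrib, Finset.sum_add_distrib, ← Finset.mul_sum]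
  rw [hA, hB, hC]
  ring

/-- Delocalization: the eigenvalue equation at i and Cauchy–Schwarz over its K neighbours give λ‖w
i‖ ≤ √(Kd). -/
theorem norm_sq_eigenvector_le (hsδ : s ∣ δ) (hsd : s ∣ d)
    (hE0 : ∀ i k, ¬ InBand d δ s i k → E i k = 0)
    (hE1 : ∀ i k, ‖E i k‖ = 1 ∨ E i k = 0)
    (heig : ∀ i, ∑ k, E i k * w k = lam * w i) (hw : ∑ i, ‖w i‖ ^ 2 = d)
    (hK : 0 < bandDegree d δ s) (hlam : (bandDegree d δ s : ℝ) / 2 ≤ lam) (i : ZMod d) :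
    ‖w i‖ ^ 2 ≤ 4 * d / bandDegree d δ s := by
  have hE : ∀ i k, ‖E i k‖ ≤ 1 := fun i k => by
    rcases hE1 i k with h | h <;> simp [h]
  set K : ℝ := ((bandDegree d δ s : ℕ) : ℝ) with hKdef
  have hK0 : 0 < K := Nat.cast_pos.mpr hK
  have h1 : lam * ‖w i‖ ≤ ∑ k ∈ bandNeighbors d δ s i, ‖w k‖ := by
    have h := congrArg norm (heig i)
    rw [norm_mul, Complex.norm_real, Real.norm_of_nonneg (by linarith)] at h
    rw [← h, ← sum_bandNeighbors_eq (fun k hk => by rw [hE0 i k hk, zero_mul])]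
    refine (norm_sum_le _ _).trans (Finset.sum_le_sum fun k _ => ?_)
    rw [norm_mul]
    exact mul_le_of_le_one_left (norm_nonneg _) (hE i k)
  have h2 : (∑ k ∈ bandNeighbors d δ s i, ‖w k‖) ^ 2 ≤ K * d := by
    refine sq_sum_le_card_mul_sum_sq.trans ?_
    rw [card_bandNeighbors hsδ hsd, ← hw]
    gcongr
    exact Finset.subset_univ _
  have h3 : K / 2 * ‖w i‖ ≤ ∑ k ∈ bandNeighbors d δ s i, ‖w k‖ :=
    (mul_le_mul_of_nonneg_right hlam (norm_nonneg _)).trans h1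
  have h4 := (pow_le_pow_left₀ (by positivity) h3 2).trans h2
  rw [le_div_iff₀ hK0]
  have h5 : K * (‖w i‖ ^ 2 * K) ≤ K * (4 * d) := by nlinarith
  exact le_of_mul_le_mul_left h5 hK0

/-- Passes from twisted to plain differences; the price is ‖1 - E i k‖‖w k‖, and the uniform bound
on w turns its square into the defect. -/
theorem sum_norm_sub_sq_le_of_bound {B : ℝ} (hB : ∀ k, ‖w k‖ ^ 2 ≤ B) :
    ∑ i, ∑ k ∈ bandNeighbors d δ s i, ‖w k - w i‖ ^ 2 ≤
      2 * ∑ i, ∑ k ∈ bandNeighbors d δ s i, ‖w i - E i k * w k‖ ^ 2 +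
        2 * (B * bandDefect d δ s E) := by
  rw [bandDefect]
  simp only [Finset.mul_sum, ← Finset.sum_add_distrib]
  refine Finset.sum_le_sum fun i _ => Finset.sum_le_sum fun k _ => ?_
  have e : w k - w i = (1 - E i k) * w k - (w i - E i k * w k) := by ring
  have h := norm_sub_le ((1 - E i k) * w k) (w i - E i k * w k)
  rw [← e, norm_mul] at h
  have h2 := pow_le_pow_left₀ (norm_nonneg _) h 2
  have h3 := mul_le_mul_of_nonneg_right (hB k) (sq_nonneg ‖1 - E i k‖)
  nlinarith [sq_nonneg (‖1 - E i k‖ * ‖w k‖ - ‖w i - E i k * w k‖)]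

/-- Angular synchronization on the band graph, for a connection close to the trivial one. -/
theorem exists_sum_norm_one_sub_sq_le (hsδ : s ∣ δ) (hsd : s ∣ d) (hsl : s < δ) (hδd : δ < d)
    (hE0 : ∀ i k, ¬ InBand d δ s i k → E i k = 0)
    (hE1 : ∀ i k, ‖E i k‖ = 1 ∨ E i k = 0)
    (heig : ∀ i, ∑ k, E i k * w k = lam * w i)
    (hR : (∑ i, ∑ k, E i k).re ≤ lam * d) (hw : ∑ i, ‖w i‖ ^ 2 = d)
    {y : ZMod d → ℂ} (hy : ∀ i, ‖y i‖ ≤ 1) (hyw : ∀ i, w i ≠ 0 → y i = w i / (‖w i‖ : ℂ)) :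
    ∃ φ : ℂ, ‖φ‖ = 1 ∧
      ∑ i, ‖1 - φ * y i‖ ^ 2 ≤ 20736 * ((d : ℝ) ^ 3 / (δ : ℝ) ^ 4 * bandDefect d δ s E) := by
  have hδ : 0 < δ := by omega
  have hKδ := le_bandDegree (δ := δ) hsd hδd.le
  have hδR : (0 : ℝ) < δ := by exact_mod_cast hδ
  have hdR : (δ : ℝ) < d := by exact_mod_cast hδd
  have hd0 : (0 : ℝ) < d := hδR.trans hdR
  have hKR : (δ : ℝ) ≤ bandDegree d δ s := by exact_mod_cast hKδ
  have hdef := degree_sub_mul_le_bandDefect hsδ hsd hE0 hE1 hR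
  set η := bandDefect d δ s E with hη
  have hη0 : 0 ≤ η := by
    rw [hη, bandDefect]
    positivity
  by_cases hlam : (bandDegree d δ s : ℝ) / 2 ≤ lam
  · obtain ⟨φ, hφ, h⟩ := exists_sum_norm_one_sub_mul_sq_le w y ((d : ℂ)⁻¹ * ∑ j, w j)
      (by rw [hw, ZMod.card]) hy hyw
    refine ⟨φ, hφ, h.trans ?_⟩
    have hbd : ∀ i, ‖w i‖ ^ 2 ≤ 4 * d / δ := fun i =>
      (norm_sq_eigenvector_le hsδ hsd hE0 hE1 heig hw (by omega) hlam i).trans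
        (div_le_div_of_nonneg_left (by positivity) hδR hKR)
    have hS := sum_norm_sub_sq_le_of_bound (δ := δ) (s := s) (E := E) hbd
    have hS2 := sum_norm_sub_mul_sq_le hsδ hsd hE0 hE1 heig hw
    have hone : 1 ≤ (d : ℝ) / δ := by
      rw [le_div_iff₀ hδR]
      linarith
    -- 2 · 2η + 2 · (4d/δ)η, with 1 ≤ d/δ. Then 108 · 12 = 1296, and the rounding factor 16 gives
    -- 20736.
    have hS3 : ∑ i, ∑ k ∈ bandNeighbors d δ s i, ‖w k - w i‖ ^ 2 ≤ 12 * (d / δ * η) := by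
      rw [← hη, mul_div_assoc] at hS
      have h1 := mul_le_mul_of_nonneg_right hone hη0
      linarith
    have hP := (sum_norm_sub_mean_sq_le_band hsδ hsd hsl hδd w).trans
      (mul_le_mul_of_nonneg_left hS3 (by positivity))
    have e : 108 * ((d : ℝ) ^ 2 / (δ : ℝ) ^ 3) * (12 * (d / δ * η)) =
        1296 * ((d : ℝ) ^ 3 / (δ : ℝ) ^ 4 * η) := by
      field_simp
      ring
    rw [e] at hP
    linarith
  -- Here η ≥ (K - λ)d ≥ δd/2, and the trivial bound 4d is already small enough.
  · push Not at hlam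
    refine ⟨1, norm_one, ?_⟩
    have h1 : ∀ i, ‖1 - 1 * y i‖ ^ 2 ≤ 4 := fun i => by
      have : ‖1 - 1 * y i‖ ≤ 2 := by
        rw [one_mul]
        refine (norm_sub_le _ _).trans ?_
        rw [norm_one]
        linarith [hy i]
      nlinarith [norm_nonneg (1 - 1 * y i)]
    have h4 := Finset.sum_le_sum fun i (_ : i ∈ Finset.univ) => h1 i
    simp only [Finset.sum_const, Finset.card_univ, ZMod.card, nsmul_eq_mul] at h4
    have hη1 : (δ : ℝ) / 2 * d ≤ η := by
      refine le_trans (mul_le_mul_of_nonneg_right ?_ hd0.le) hdef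
      linarith
    have h5 : (d : ℝ) / 2 ≤ (d : ℝ) ^ 3 / (δ : ℝ) ^ 4 * η := by
      have ha : (d : ℝ) ^ 3 / (δ : ℝ) ^ 4 * (δ / 2 * d) ≤ (d : ℝ) ^ 3 / (δ : ℝ) ^ 4 * η := by
        gcongr
      refine le_trans ?_ ha
      have e : (d : ℝ) ^ 3 / (δ : ℝ) ^ 4 * (δ / 2 * d) = d / 2 * (d / δ) ^ 3 := by
        field_simp
      rw [e]
      refine le_mul_of_one_le_right (by positivity) (one_le_pow₀ ?_)
      rw [le_div_iff₀ hδR]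
      linarith
    linarith

end Estimate

end Synchronization

/-! ### The least-squares inversion step -/

section Measurements

variable {d δ s D : ℕ}

/-- The conjugate transpose of a matrix. -/
noncomputable def conjTrans (X : MatSpace d) : MatSpace d :=
  WithLp.toLp 2 fun p => star (X (p.2, p.1))

theorem conjTrans_outer (x : ZMod d → ℂ) : conjTrans (outer x) = outer x := by
  ext p
  simp [conjTrans, outer, mul_comm]

theorem conjTrans_mem_bandSpace {X : MatSpace d} (hX : X ∈ bandSpace d δ s) :
    conjTrans X ∈ bandSpace d δ s := by
  intro i k h
  have : X (k, i) = 0 := hX k i fun h' => h ((inBand_comm k i).mp h')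
  simp [conjTrans, this]

theorem bandProj_apply_of_inBand {X : MatSpace d} {i k : ZMod d} (h : InBand d δ s i k) :
    bandProj d δ s X (i, k) = X (i, k) := by
  simp [bandProj, h]

theorem bandProj_mem_bandSpace (X : MatSpace d) : bandProj d δ s X ∈ bandSpace d δ s :=
  (mem_bandSpace_iff d δ s _).mpr ⟨X, rfl⟩

variable [NeZero d] {m : Fin D → ZMod d → ℂ}

theorem measOp_apply (X : MatSpace d) (p : Fin (d / s) × Fin D) :
    measOp d s D m X p = inner ℂ (outer (shift (s * p.1) (m p.2))) X := rfl

theorem inner_outer_conjTrans (u : ZMod d → ℂ) (X : MatSpace d) :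
    inner ℂ (outer u) (conjTrans X) = star (inner ℂ (outer u) X) := by
  rw [PiLp.inner_apply, PiLp.inner_apply, star_sum, ← Equiv.sum_comp (Equiv.prodComm _ _)]
  refine Finset.sum_congr rfl fun p _ => ?_
  simp [conjTrans, outer]
  exact Or.inl (by ring)

theorem measOp_conjTrans (X : MatSpace d) (p : Fin (d / s) × Fin D) :
    measOp d s D m (conjTrans X) p = star (measOp d s D m X p) := by
  rw [measOp_apply, measOp_apply, inner_outer_conjTrans]

/-- The measurements only see the band. -/
theorem measOp_bandProj (hsd : s ∣ d) (hm : ∀ j i, m j i ≠ 0 → i.val < δ) (X : MatSpace d) :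
    measOp d s D m (bandProj d δ s X) = measOp d s D m X := by
  ext p
  rw [measOp_apply, measOp_apply, PiLp.inner_apply, PiLp.inner_apply]
  refine Finset.sum_congr rfl fun q _ => ?_
  obtain ⟨i, k⟩ := q
  by_cases h : InBand d δ s i k
  · rw [bandProj_apply_of_inBand h]
  · have hz : outer (shift (s * p.1) (m p.2)) (i, k) = 0 := by
      by_contra hne
      have h1 : shift (s * p.1) (m p.2) i ≠ 0 := fun h0 => hne (by simp [outer, h0])
      have h2 : shift (s * p.1) (m p.2) k ≠ 0 := fun h0 => hne (by simp [outer, h0])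
      -- The shifted mask lives on one block, so its rank-one matrix lives on one square of the
      -- band.
      have hb : ∀ j, shift (s * p.1) (m p.2) j ≠ 0 → InBlock d δ s p.1 j := fun j hj =>
        ⟨_, hm _ _ hj, by
          rw [Nat.cast_add, ZMod.natCast_zmod_val]
          ring⟩
      exact h ((inBand_iff_exists_inBlock hsd i k).mpr ⟨p.1, hb i h1, hb k h2⟩)
    rw [hz]
    simp

variable {y : EuclideanSpace ℂ (Fin (d / s) × Fin D)} {X : MatSpace d}

/-- The normal equations of the least-squares problem. -/
theorem IsBandSolution.inner_eq_zero (hX : IsBandSolution d δ s D m y X) {Z : MatSpace d}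
    (hZ : Z ∈ bandSpace d δ s) :
    inner ℂ (y - measOp d s D m X) (measOp d s D m Z) = 0 := by
  set K := (bandSpace d δ s).map (measOp d s D m)
  have hmem : measOp d s D m X ∈ K := Submodule.mem_map_of_mem hX.1
  refine (Submodule.norm_eq_iInf_iff_inner_eq_zero K hmem).mp ?_ _ (Submodule.mem_map_of_mem hZ)
  have : Nonempty K := ⟨⟨_, hmem⟩⟩
  refine le_antisymm (le_ciInf ?_) (ciInf_le ⟨0, ?_⟩ (⟨_, hmem⟩ : K))
  · rintro ⟨_, Z, hZ, rfl⟩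
    rw [norm_sub_rev, norm_sub_rev y]
    exact hX.2 Z hZ
  · rintro _ ⟨w, rfl⟩
    exact norm_nonneg _

/-- Both residuals are orthogonal to 𝒜(X - Y), hence so is their difference, which is 𝒜(X - Y)
itself. With injectivity this gives uniqueness. -/
theorem IsBandSolution.measOp_sub_eq_zero {Y : MatSpace d} (hX : IsBandSolution d δ s D m y X)
    (hY : IsBandSolution d δ s D m y Y) : measOp d s D m (X - Y) = 0 := by
  have h1 := hX.inner_eq_zero (sub_mem hX.1 hY.1)
  have h2 := hY.inner_eq_zero (sub_mem hX.1 hY.1)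
  rw [← inner_self_eq_zero (𝕜 := ℂ)]
  conv_lhs => lhs; rw [map_sub]
  rw [← sub_sub_sub_cancel_left _ _ y, inner_sub_left, h1, h2, sub_zero]

theorem eq_zero_of_measOp_eq_zero (hinj : Function.Injective (measOpBand d δ s D m))
    {Z : MatSpace d} (hZ : Z ∈ bandSpace d δ s) (h : measOp d s D m Z = 0) : Z = 0 := by
  have h1 : measOpBand d δ s D m ⟨Z, hZ⟩ = measOpBand d δ s D m 0 := by
    rw [map_zero]
    exact h
  exact congrArg Subtype.val (hinj h1)

/-- For real data the least-squares solution is Hermitian. -/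
theorem IsBandSolution.conjTrans_eq (hX : IsBandSolution d δ s D m y X)
    (hinj : Function.Injective (measOpBand d δ s D m)) (hy : ∀ p, star (y p) = y p) :
    conjTrans X = X := by
  -- For real y, taking adjoints conjugates the residual, so X* solves the same problem and
  -- uniqueness applies.
  have hnorm : ∀ Z, ‖measOp d s D m (conjTrans Z) - y‖ = ‖measOp d s D m Z - y‖ := by
    intro Z
    rw [← sq_eq_sq₀ (norm_nonneg _) (norm_nonneg _), EuclideanSpace.norm_sq_eq,
      EuclideanSpace.norm_sq_eq]
    refine Finset.sum_congr rfl fun p _ => ?_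
    rw [PiLp.sub_apply, PiLp.sub_apply, measOp_conjTrans]
    conv_lhs => rw [← hy p, ← star_sub, norm_star]
  have hX' : IsBandSolution d δ s D m y (conjTrans X) := by
    refine ⟨conjTrans_mem_bandSpace hX.1, fun Z hZ => ?_⟩
    rw [hnorm]
    exact hX.2 Z hZ
  exact sub_eq_zero.mp (eq_zero_of_measOp_eq_zero hinj (sub_mem hX'.1 hX.1)
    (hX'.measOp_sub_eq_zero hX))

theorem norm_toComplexVec {ι : Type*} [Fintype ι] (n : EuclideanSpace ℝ ι) :
    ‖toComplexVec n‖ = ‖n‖ := by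
  rw [← sq_eq_sq₀ (norm_nonneg _) (norm_nonneg _), EuclideanSpace.norm_sq_eq,
    EuclideanSpace.norm_sq_eq]
  simp [toComplexVec]

theorem norm_le_of_inner_sub_self_eq_zero {F : Type*} [NormedAddCommGroup F]
    [InnerProductSpace ℂ F] {u a : F} (h : inner ℂ (u - a) a = 0) : ‖a‖ ≤ ‖u‖ := by
  have h1 := norm_add_sq_eq_norm_sq_add_norm_sq_of_inner_eq_zero (u - a) a h
  rw [sub_add_cancel] at h1
  refine le_of_sq_le_sq ?_ (norm_nonneg _)
  nlinarith [mul_self_nonneg ‖u - a‖]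

/-- Stability of the linear inversion step. -/
theorem IsBandSolution.sigmaMin_mul_norm_sub_le (hsd : s ∣ d)
    (hm : ∀ j i, m j i ≠ 0 → i.val < δ) (x₀ : ZMod d → ℂ)
    (n : EuclideanSpace ℝ (Fin (d / s) × Fin D))
    (hX : IsBandSolution d δ s D m (measOp d s D m (outer x₀) + toComplexVec n) X) :
    sigmaMin (E := bandSpace d δ s) (measOpBand d δ s D m) *
      ‖X - bandProj d δ s (outer x₀)‖ ≤ ‖n‖ := by
  have hZ : X - bandProj d δ s (outer x₀) ∈ bandSpace d δ s :=
    sub_mem hX.1 (bandProj_mem_bandSpace _)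
  refine (sigmaMin_domRestrict_mul_norm_le (measOp d s D m) (bandSpace d δ s) hZ).trans ?_
  have h := hX.inner_eq_zero hZ
  have e : measOp d s D m (outer x₀) + toComplexVec n - measOp d s D m X =
      toComplexVec n - measOp d s D m (X - bandProj d δ s (outer x₀)) := by
    rw [map_sub, measOp_bandProj hsd hm]
    abel
  rw [e] at h
  exact (norm_le_of_inner_sub_self_eq_zero h).trans (norm_toComplexVec n).le

end Measurements

/-! ### Phases, and the reduction to a nearly trivial connection -/

section Phases

theorem sgn_of_ne_zero {c z : ℂ} (hz : z ≠ 0) : sgn c z = z / (‖z‖ : ℂ) := by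
  simp [sgn, hz]

theorem norm_sgn_of_ne_zero {c z : ℂ} (hz : z ≠ 0) : ‖sgn c z‖ = 1 := by
  rw [sgn_of_ne_zero hz, norm_div, Complex.norm_real, norm_norm,
    div_self (norm_ne_zero_iff.mpr hz)]

theorem norm_sgn_eq_one_or {c : ℂ} (hc : c = 0 ∨ c = 1) (z : ℂ) : ‖sgn c z‖ = 1 ∨ sgn c z = 0 := by
  by_cases hz : z = 0
  · rcases hc with rfl | rfl <;> simp [sgn, hz]
  · exact Or.inl (norm_sgn_of_ne_zero hz)

theorem norm_sgn_le {c : ℂ} (hc : c = 0 ∨ c = 1) (z : ℂ) : ‖sgn c z‖ ≤ 1 := by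
  rcases norm_sgn_eq_one_or hc z with h | h <;> simp [h]

theorem star_sgn {c : ℂ} (hc : c = 0 ∨ c = 1) (z : ℂ) : star (sgn c z) = sgn c (star z) := by
  by_cases hz : z = 0
  · rcases hc with rfl | rfl <;> simp [sgn, hz]
  · have hz' : star z ≠ 0 := star_ne_zero.mpr hz
    rw [sgn_of_ne_zero hz, sgn_of_ne_zero hz']
    simp

theorem sgn_ofReal_mul {c z : ℂ} {t : ℝ} (ht : 0 < t) : sgn c (t * z) = sgn c z := by
  have htc : (t : ℂ) ≠ 0 := by exact_mod_cast ht.ne'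
  by_cases hz : z = 0
  · simp [hz]
  · rw [sgn_of_ne_zero hz, sgn_of_ne_zero (mul_ne_zero htc hz), norm_mul, Complex.norm_real,
      Real.norm_of_nonneg ht.le, Complex.ofReal_mul, mul_div_mul_left _ _ htc]

theorem phaseDist_le {d : ℕ} [NeZero d] (x y : EuclideanSpace ℂ (ZMod d)) {φ : ℂ}
    (hφ : ‖φ‖ = 1) : phaseDist x y ≤ ‖x - φ • y‖ := by
  have hbdd : BddBelow (Set.range fun θ : Set.Icc (0 : ℝ) (2 * Real.pi) =>
      ‖x - Complex.exp (Complex.I * (θ : ℝ)) • y‖) :=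
    ⟨0, by rintro _ ⟨t, rfl⟩; exact norm_nonneg _⟩
  obtain ⟨θ, hθ, h⟩ : ∃ θ ∈ Set.Icc (0 : ℝ) (2 * Real.pi), Complex.exp (Complex.I * θ) = φ := by
    have h1 := Complex.norm_mul_exp_arg_mul_I φ
    rw [hφ, Complex.ofReal_one, one_mul, mul_comm] at h1
    have hlo := Complex.neg_pi_lt_arg φ
    have hhi := Complex.arg_le_pi φ
    -- `Complex.arg` takes values in (-π, π], so negative arguments are moved up by 2π.
    rcases le_or_gt 0 φ.arg with h0 | h0
    · exact ⟨φ.arg, ⟨h0, by linarith [Real.pi_pos]⟩, h1⟩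
    · refine ⟨φ.arg + 2 * Real.pi, ⟨by linarith, by linarith⟩, ?_⟩
      push_cast
      rw [mul_add, mul_comm Complex.I (2 * (Real.pi : ℂ)), Complex.exp_add, h1,
        Complex.exp_two_pi_mul_I, mul_one]
  rw [← h]
  exact ciInf_le hbdd ⟨θ, hθ⟩

variable {d δ s : ℕ}

theorem phaseMatrix_apply_of_inBand (c : ℂ) (X : MatSpace d) {i k : ZMod d}
    (h : InBand d δ s i k) : phaseMatrix d δ s c X i k = sgn c (X (i, k)) := by
  simp [phaseMatrix, bandProj, h]

theorem phaseMatrix_apply_of_not_inBand (c : ℂ) (X : MatSpace d) {i k : ZMod d}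
    (h : ¬ InBand d δ s i k) : phaseMatrix d δ s c X i k = 0 := by
  simp [phaseMatrix, bandProj, h]

theorem isHermitian_phaseMatrix {c : ℂ} (hc : c = 0 ∨ c = 1) {X : MatSpace d}
    (hX : conjTrans X = X) : (phaseMatrix d δ s c X).IsHermitian := by
  ext i k
  rw [Matrix.conjTranspose_apply]
  by_cases h : InBand d δ s i k
  · have h' := (inBand_comm i k).mp h
    have e : X (i, k) = star (X (k, i)) := by
      conv_lhs => rw [← hX]
      rfl
    rw [phaseMatrix_apply_of_inBand c X h, phaseMatrix_apply_of_inBand c X h', star_sgn hc, e]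
  · have h' := fun h' => h ((inBand_comm k i).mp h')
    rw [phaseMatrix_apply_of_not_inBand c X h, phaseMatrix_apply_of_not_inBand c X h', star_zero]

theorem IsLeadingEigenvector.exists_normalized [NeZero d] {M : Matrix (ZMod d) (ZMod d) ℂ}
    {v : ZMod d → ℂ} (hv : IsLeadingEigenvector M v) :
    ∃ t : ℝ, 0 < t ∧ ∑ i, ‖(t : ℂ) * v i‖ ^ 2 = d := by
  have hpos : 0 < ∑ i, ‖v i‖ ^ 2 := by
    obtain ⟨i, hi⟩ := Function.ne_iff.mp hv.1
    have hi' : 0 < ‖v i‖ := norm_pos_iff.mpr hi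
    exact Finset.sum_pos' (fun _ _ => sq_nonneg _) ⟨i, Finset.mem_univ _, by positivity⟩
  have hd : (0 : ℝ) < d := by exact_mod_cast NeZero.pos d
  refine ⟨√(d / ∑ i, ‖v i‖ ^ 2), by positivity, ?_⟩
  simp only [norm_mul, mul_pow, Complex.norm_real, Real.norm_eq_abs, sq_abs]
  rw [← Finset.mul_sum, Real.sq_sqrt (by positivity), div_mul_cancel₀ _ hpos.ne']

/-- Angular synchronization: the leading eigenvector of a Hermitian matrix of phases on the band
recovers the phases of `x₀`. -/
theorem phaseDist_sq_le [NeZero d] (hsδ : s ∣ δ) (hsd : s ∣ d) (hsl : s < δ) (hδd : δ < d)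
    {x₀ : ZMod d → ℂ} (hx₀ : ∀ i, x₀ i ≠ 0) {X : MatSpace d} (hX : conjTrans X = X)
    {c₁ c₂ : ℂ} (hc₁ : c₁ = 0 ∨ c₁ = 1) (hc₂ : c₂ = 0 ∨ c₂ = 1) {v : ZMod d → ℂ}
    (hv : IsLeadingEigenvector (phaseMatrix d δ s c₁ X) v) :
    phaseDist (sgnVec c₂ x₀) (sgnVec c₂ v) ^ 2 ≤ 20736 * ((d : ℝ) ^ 3 / (δ : ℝ) ^ 4 *
      ∑ i, ∑ k ∈ bandNeighbors d δ s i,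
        ‖phaseMatrix d δ s c₁ X i k - sgn c₂ (x₀ i) * star (sgn c₂ (x₀ k))‖ ^ 2) := by
  obtain ⟨t, ht, hnorm⟩ := hv.exists_normalized
  obtain ⟨_, lam, hlam, hmax⟩ := hv
  set M := phaseMatrix d δ s c₁ X with hM
  have hH : M.IsHermitian := isHermitian_phaseMatrix hc₁ hX
  set g : ZMod d → ℂ := fun i => sgn c₂ (x₀ i)
  have hg1 : ∀ i, ‖g i‖ = 1 := fun i => norm_sgn_of_ne_zero (hx₀ i)
  have hgg : ∀ i, star (g i) * g i = 1 := fun i => by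
    rw [RCLike.star_def, Complex.conj_mul', hg1]
    simp
  have hgg' : ∀ i, g i * star (g i) = 1 := fun i => by rw [mul_comm, hgg]
  have hgs : ∀ i, ‖star (g i)‖ = 1 := fun i => by rw [norm_star, hg1]
  -- Gauge change by the true phases: x₀ becomes positive, and v, rescaled, becomes w = star g · t v
  -- with the same eigenvalue.
  set E : ZMod d → ZMod d → ℂ := fun i k => star (g i) * M i k * g k with hE
  have hE0 : ∀ i k, ¬ InBand d δ s i k → E i k = 0 := fun i k h => by
    simp [hE, hM, phaseMatrix_apply_of_not_inBand c₁ X h]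
  have hE1 : ∀ i k, ‖E i k‖ = 1 ∨ E i k = 0 := fun i k => by
    by_cases h : InBand d δ s i k
    · have h1 : M i k = sgn c₁ (X (i, k)) := phaseMatrix_apply_of_inBand c₁ X h
      rcases norm_sgn_eq_one_or hc₁ (X (i, k)) with h2 | h2
      · left
        simp only [hE]
        rw [norm_mul, norm_mul, hgs, hg1, h1, h2]
        norm_num
      · right
        simp only [hE]
        rw [h1, h2]
        simp
    · exact Or.inr (hE0 i k h)
  have heig : ∀ i, ∑ k, E i k * (star (g k) * (t * v k)) = lam * (star (g i) * (t * v i)) := by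
    intro i
    have h := congrFun hlam i
    simp only [Matrix.mulVec, dotProduct, Pi.smul_apply, smul_eq_mul] at h
    have e : ∀ k, E i k * (star (g k) * (t * v k)) = star (g i) * t * (M i k * v k) := fun k => by
      simp only [hE]
      linear_combination (star (g i) * M i k * t * v k) * hgg' k
    simp only [e]
    rw [← Finset.mul_sum, h]
    ring
  -- The Rayleigh quotient of M at g, which is that of E at the constant vector.
  have hR : (∑ i, ∑ k, E i k).re ≤ lam * d := by
    have h := re_dotProduct_mulVec_le hH hmax g
    have e : star g ⬝ᵥ M.mulVec g = ∑ i, ∑ k, E i k := by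
      simp only [dotProduct, Matrix.mulVec, Finset.mul_sum, hE, Pi.star_apply, mul_assoc]
    rw [e] at h
    simpa [hg1, ZMod.card] using h
  have hw : ∑ i, ‖star (g i) * (t * v i)‖ ^ 2 = (d : ℝ) := by
    rw [← hnorm]
    refine Finset.sum_congr rfl fun i _ => ?_
    rw [norm_mul, hgs, one_mul]
  obtain ⟨φ, hφ, h⟩ := exists_sum_norm_one_sub_sq_le hsδ hsd hsl hδd hE0 hE1 heig hR hw
    (y := fun i => star (g i) * sgn c₂ (v i))
    (fun i => by
      rw [norm_mul, hgs, one_mul]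
      exact norm_sgn_le hc₂ _)
    (fun i hi => by
      have h1 : (t : ℂ) * v i ≠ 0 := right_ne_zero_of_mul hi
      rw [norm_mul, hgs, one_mul, ← sgn_ofReal_mul (c := c₂) (z := v i) ht, sgn_of_ne_zero h1]
      ring)
  have hdist : ‖sgnVec c₂ x₀ - φ • sgnVec c₂ v‖ ^ 2 =
      ∑ i, ‖1 - φ * (star (g i) * sgn c₂ (v i))‖ ^ 2 := by
    rw [EuclideanSpace.norm_sq_eq]
    refine Finset.sum_congr rfl fun i _ => ?_
    congr 1
    change ‖g i - φ * sgn c₂ (v i)‖ = _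
    rw [← one_mul ‖g i - _‖, ← hgs i, ← norm_mul, mul_sub, hgg]
    congr 2
    ring
  have hdef : bandDefect d δ s E = ∑ i, ∑ k ∈ bandNeighbors d δ s i,
      ‖M i k - g i * star (g k)‖ ^ 2 := by
    refine Finset.sum_congr rfl fun i _ => Finset.sum_congr rfl fun k _ => ?_
    congr 1
    rw [← mul_one ‖M i k - _‖, ← hg1 k, ← one_mul ‖M i k - _‖, ← hgs i, ← norm_mul, ← norm_mul,
      norm_sub_rev]
    congr 1
    simp only [hE]
    linear_combination star (g k) * g k * hgg i + hgg k
  rw [hdef, ← hdist] at h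
  exact (pow_le_pow_left₀ (Real.iInf_nonneg fun _ => norm_nonneg _)
    (phaseDist_le _ _ hφ) 2).trans h

/-- Entrywise normalization is stable in the Frobenius norm. -/
theorem sum_norm_phaseMatrix_sub_sq_le [NeZero d] {x₀ : ZMod d → ℂ} (hx₀ : ∀ i, x₀ i ≠ 0)
    {X : MatSpace d} {c₁ c₂ : ℂ} (hc₁ : c₁ = 0 ∨ c₁ = 1) {b : ℝ} (hb : 0 < b)
    (hbx : ∀ i, b ≤ ‖x₀ i‖ ^ 2) :
    ∑ i, ∑ k ∈ bandNeighbors d δ s i,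
        ‖phaseMatrix d δ s c₁ X i k - sgn c₂ (x₀ i) * star (sgn c₂ (x₀ k))‖ ^ 2 ≤
      (2 / b) ^ 2 * ‖X - bandProj d δ s (outer x₀)‖ ^ 2 := by
  rw [EuclideanSpace.norm_sq_eq, Fintype.sum_prod_type, Finset.mul_sum]
  refine Finset.sum_le_sum fun i _ => ?_
  rw [Finset.mul_sum]
  refine le_trans (Finset.sum_le_sum fun k hk => ?_)
    (Finset.sum_le_sum_of_subset_of_nonneg (Finset.subset_univ _) fun _ _ _ => by positivity)
  have h := mem_bandNeighbors.mp hk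
  rw [phaseMatrix_apply_of_inBand c₁ X h, ← mul_pow]
  refine pow_le_pow_left₀ (norm_nonneg _) ?_ 2
  set z := x₀ i * star (x₀ k) with hz
  have hz0 : z ≠ 0 := mul_ne_zero (hx₀ i) (star_ne_zero.mpr (hx₀ k))
  have e : sgn c₂ (x₀ i) * star (sgn c₂ (x₀ k)) = z / (‖z‖ : ℂ) := by
    rw [sgn_of_ne_zero (hx₀ i), sgn_of_ne_zero (hx₀ k), hz]
    simp
    field_simp
  have e2 : (X - bandProj d δ s (outer x₀)) (i, k) = X (i, k) - z := by
    rw [PiLp.sub_apply, bandProj_apply_of_inBand h]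
    rfl
  have hbz : b ≤ ‖z‖ := by
    rw [hz, norm_mul, norm_star]
    refine le_of_sq_le_sq ?_ (by positivity)
    rw [mul_pow, sq b]
    exact mul_le_mul (hbx i) (hbx k) hb.le (by positivity)
  rw [e, e2]
  refine (norm_normalize_sub_le hz0 (norm_sgn_le hc₁ _) fun h0 => sgn_of_ne_zero h0).trans ?_
  rw [div_mul_eq_mul_div]
  exact div_le_div_of_nonneg_left (by positivity) hb hbz

end Phases

/-! ### Final constants and assembly -/

theorem sqrt_bound {d δ s a : ℝ} (hδ : 0 < δ) (hd : δ ≤ d) (hs : 1 ≤ s) {x : ℝ} (ha : 0 ≤ a)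
    (hx : x ^ 2 ≤ 20736 * (d ^ 3 / δ ^ 4 * (2 * a) ^ 2)) :
    x ≤ 288 * (d ^ 2 * s / δ ^ (5 / 2 : ℝ)) * a := by
  have hd0 : 0 < d := hδ.trans_le hd
  have hp : (δ ^ (5 / 2 : ℝ)) ^ 2 = δ ^ 5 := by
    rw [← Real.rpow_natCast, ← Real.rpow_mul hδ.le, ← Real.rpow_natCast]
    norm_num
  refine le_of_sq_le_sq (hx.trans ?_) (by positivity)
  rw [mul_pow, mul_pow, mul_pow (288 : ℝ), div_pow, hp]
  have h : d ^ 3 / δ ^ 4 ≤ (d ^ 2 * s) ^ 2 / δ ^ 5 := by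
    rw [div_le_div_iff₀ (by positivity) (by positivity)]
    have e : (d ^ 2 * s) ^ 2 * δ ^ 4 = (d ^ 3 * δ ^ 4) * (d * s ^ 2) := by ring
    have e' : d ^ 3 * δ ^ 5 = (d ^ 3 * δ ^ 4) * δ := by ring
    rw [e, e']
    refine mul_le_mul_of_nonneg_left ?_ (by positivity)
    exact hd.trans (le_mul_of_one_le_right hd0.le (one_le_pow₀ hs))
  have h2 := mul_le_mul_of_nonneg_right h (sq_nonneg a)
  linarith

/-- The two sides differ by the factor τN/A ≥ 1. For n = 0, division by zero makes both sides 0, as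
the convention for infinite SNR demands. -/
theorem inv_mul_div_le_condNumber_bound {σ τ N A n b : ℝ} (hσ : 0 < σ) (hA : 0 < A) (hb : 0 < b)
    (hn : 0 ≤ n) (h : A ≤ τ * N) :
    σ⁻¹ * n / b ≤ τ / σ * N / (A / n * b) := by
  rcases hn.eq_or_lt with rfl | hn
  · simp
  · have e : τ / σ * N / (A / n * b) = σ⁻¹ * n / b * (τ * N / A) := by
      field_simp
    rw [e]
    refine le_mul_of_one_le_right (by positivity) ?_
    rwa [le_div_iff₀ hA, one_mul]

end Ptycho

theorem mainTheorem4 :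
    ∃ C : ℝ, 0 < C ∧
      ∀ (d δ s D : ℕ) [NeZero d], s < δ → δ < d → s ∣ δ → δ ∣ d →
      -- masks supported on the first `δ` indices, with `𝒜` injective on the band space
      ∀ (m : Fin D → ZMod d → ℂ), (∀ j i, m j i ≠ 0 → i.val < δ) →
      Function.Injective (Ptycho.measOpBand d δ s D m) →
      -- the ground truth, the noise and the estimate `X` from the noisy measurements
      ∀ (x₀ : ZMod d → ℂ), (∀ i, x₀ i ≠ 0) →
      ∀ (n : EuclideanSpace ℝ (Fin (d / s) × Fin D)) (X : Ptycho.MatSpace d),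
      Ptycho.IsBandSolution d δ s D m
        (Ptycho.measOp d s D m (Ptycho.outer x₀) + Ptycho.toComplexVec n) X →
      -- the values of `sgn 0` used for `X` and for `v`
      ∀ (c₁ c₂ : ℂ), (c₁ = 0 ∨ c₁ = 1) → (c₂ = 0 ∨ c₂ = 1) →
      ∀ (v : ZMod d → ℂ),
      Ptycho.IsLeadingEigenvector (Ptycho.phaseMatrix d δ s c₁ X) v →
      Ptycho.phaseDist (Ptycho.sgnVec c₂ x₀) (Ptycho.sgnVec c₂ v) ≤
          C * ((d : ℝ) ^ 2 * s / (δ : ℝ) ^ (5 / 2 : ℝ)) *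
            ((Ptycho.sigmaMin (E := Ptycho.bandSpace d δ s) (Ptycho.measOpBand d δ s D m))⁻¹ * ‖n‖ / ⨅ j, ‖x₀ j‖ ^ 2) ∧
      Ptycho.phaseDist (Ptycho.sgnVec c₂ x₀) (Ptycho.sgnVec c₂ v) ≤
          C * ((d : ℝ) ^ 2 * s / (δ : ℝ) ^ (5 / 2 : ℝ)) *
            (Ptycho.condNumber (E := Ptycho.bandSpace d δ s) (Ptycho.measOpBand d δ s D m) *
                ‖Ptycho.bandProj d δ s (Ptycho.outer x₀)‖ /
              (Ptycho.snr d δ s D m x₀ n * ⨅ j, ‖x₀ j‖ ^ 2)) := by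
  refine ⟨288, by norm_num, ?_⟩
  intro d δ s D _ hsl hδd hsδ hδ m hmask hinj x₀ hx₀ n X hX c₁ c₂ hc₁ hc₂ v hv
  have hsd : s ∣ d := hsδ.trans hδ
  have hs0 : 0 < s := Nat.pos_of_dvd_of_pos hsd (NeZero.pos d)
  have hδ0 : 0 < δ := by omega
  set b : ℝ := ⨅ j, ‖x₀ j‖ ^ 2 with hb
  have hbx : ∀ i, b ≤ ‖x₀ i‖ ^ 2 := fun i => ciInf_le (Set.finite_range _).bddBelow i
  have hb0 : 0 < b := by
    obtain ⟨i, hi⟩ := exists_eq_ciInf_of_finite (f := fun j => ‖x₀ j‖ ^ 2)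
    rw [hb, ← hi]
    have := norm_pos_iff.mpr (hx₀ i)
    positivity
  -- The diagonal lies in the band. A nonzero X₀ makes σ_min and ‖𝒜(X₀)‖ positive.
  have hX0 : Ptycho.bandProj d δ s (Ptycho.outer x₀) ≠ 0 := by
    intro h
    have h1 := congrArg (fun Z : Ptycho.MatSpace d => Z (0, 0)) h
    simp only at h1
    rw [Ptycho.bandProj_apply_of_inBand (Ptycho.inBand_self hsδ hsd hδ0 0)] at h1
    exact mul_ne_zero (hx₀ 0) (star_ne_zero.mpr (hx₀ 0)) h1
  have hX0mem := Ptycho.bandProj_mem_bandSpace (δ := δ) (s := s) (Ptycho.outer x₀)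
  have hσ : 0 < Ptycho.sigmaMin (E := Ptycho.bandSpace d δ s) (Ptycho.measOpBand d δ s D m) :=
    Ptycho.sigmaMin_domRestrict_pos hinj hX0mem hX0
  have hstab := hX.sigmaMin_mul_norm_sub_le hsd hmask x₀ n
  have hreal : ∀ p, star ((Ptycho.measOp d s D m (Ptycho.outer x₀) + Ptycho.toComplexVec n) p) =
      (Ptycho.measOp d s D m (Ptycho.outer x₀) + Ptycho.toComplexVec n) p := by
    intro p
    rw [PiLp.add_apply, star_add, ← Ptycho.measOp_conjTrans, Ptycho.conjTrans_outer]
    congr 1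
    exact Complex.conj_ofReal _
  have hherm := hX.conjTrans_eq hinj hreal
  have hmain := (Ptycho.phaseDist_sq_le hsδ hsd hsl hδd hx₀ hherm hc₁ hc₂ hv).trans
    (mul_le_mul_of_nonneg_left (mul_le_mul_of_nonneg_left
      (Ptycho.sum_norm_phaseMatrix_sub_sq_le (c₂ := c₂) hx₀ hc₁ hb0 hbx) (by positivity))
      (by norm_num))
  have hA0 : 0 < ‖Ptycho.measOp d s D m (Ptycho.bandProj d δ s (Ptycho.outer x₀))‖ :=
    norm_pos_iff.mpr fun h => hX0 (Ptycho.eq_zero_of_measOp_eq_zero hinj hX0mem h)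
  have hmax : ‖Ptycho.measOp d s D m (Ptycho.bandProj d δ s (Ptycho.outer x₀))‖ ≤
      Ptycho.sigmaMax (E := Ptycho.bandSpace d δ s) (Ptycho.measOpBand d δ s D m) *
        ‖Ptycho.bandProj d δ s (Ptycho.outer x₀)‖ :=
    Ptycho.norm_apply_le_sigmaMax_domRestrict_mul _ _ hX0mem
  rw [Ptycho.condNumber, Ptycho.snr]
  generalize Ptycho.sigmaMin (E := Ptycho.bandSpace d δ s)
    (Ptycho.measOpBand d δ s D m) = σ at *
  generalize Ptycho.sigmaMax (E := Ptycho.bandSpace d δ s)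
    (Ptycho.measOpBand d δ s D m) = τ at *
  have hstab' : ‖X - Ptycho.bandProj d δ s (Ptycho.outer x₀)‖ ≤ σ⁻¹ * ‖n‖ := by
    rwa [le_inv_mul_iff₀ hσ]
  have hsq : (2 / b) ^ 2 * ‖X - Ptycho.bandProj d δ s (Ptycho.outer x₀)‖ ^ 2 ≤
      (2 * (σ⁻¹ * ‖n‖ / b)) ^ 2 := by
    rw [← mul_pow]
    refine pow_le_pow_left₀ (by positivity) ?_ 2
    have := mul_le_mul_of_nonneg_left hstab' (by positivity : 0 ≤ 2 / b)
    refine this.trans (le_of_eq ?_)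
    ring
  -- 288 = √20736 · 2, the 2 coming from normalization.
  have hfirst := Ptycho.sqrt_bound (s := s) (by exact_mod_cast hδ0) (by exact_mod_cast hδd.le)
    (by exact_mod_cast hs0) (by positivity) (hmain.trans
      (mul_le_mul_of_nonneg_left (mul_le_mul_of_nonneg_left hsq (by positivity)) (by norm_num)))
  refine ⟨hfirst, hfirst.trans (mul_le_mul_of_nonneg_left ?_ (by positivity))⟩
  exact Ptycho.inv_mul_div_le_condNumber_bound hσ hA0 hb0 (norm_nonneg _) hmax
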